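/- Conventions. A \emph{character} of a group $G$ is a function $\psi\colon G\to\mathbb{C}$ of positive type that is constant on conjugacy classes and satisfies $\psi(1)=1$. The Hilbert space $\ell^\psi(G)$ is the completion of $\mathbb{C}[G]$ with respect to the semi-definite inner product determined by $\langle g,h\rangle_\psi=\psi(h^{-1}g)$. For a finite set $S$ and a closed subspace $V\subseteq \ell^\psi(G)^S$ that is invariant under left translation by $G$, let $\dim_\psi V=\sum_{s\in S}\langle P_Ve_s,e_s\rangle$, where $P_V$ is the orthogonal projection onto $V$ and $e_s$ has entry $1_G$ in position $s$ and $0$ elsewhere. For a generating set $S$ of $G$ take an exact sequence $F_2\xrightarrow{\partial_2}\mathbb{C}[G]^{(S)}\xrightarrow{\partial_1}\mathbb{C}[G]\to\mathbb{C}\to0$ of left $\mathbb{C}[G]$-modules with $F_2$ free and $\partial_1(e_s)=s-1$, apply $\ell^\psi(G)\otimes_{\mathbb{C}[G]}-$, and write $\partial_1^\psi,\partial_2^\psi$ for the resulting maps. Put $b_0^\psi(G)=1-\dim_\psi\overline{\operatorname{im}\partial_1^\psi}$ (for every group $G$) and, if $G$ is finitely generated and $S$ is finite, $b_1^\psi(G)=\dim_\psi\ker\partial_1^\psi-\dim_\psi\overline{\operatorname{im}\partial_2^\psi}$;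 these numbers do not depend on the choices. For an arbitrary group $G$ let \[ \bar b_1^\psi(G)=\liminf_{L\le G} b_1^{\psi|_L}(L)\in[0,\infty], \] the limit inferior over the directed system of all finitely generated subgroups $L\le G$. For a subgroup $H\le G$ write $\bar b_1^{\psi}(H)$ for $\bar b_1^{\psi|_H}(H)$. A subgroup $K\le G$ is \emph{$\psi$-regular} if $\psi(k)=0$ for all $k\in K\setminus\{1\}$. Lemma. Let $G$ be a group, $H\le G$ a subgroup and $a\in G$ an element with $G=\langle H,a\rangle$, and let $\psi$ be a character of $G$. Assume that $aHa^{-1}\cap H$ contains a $\psi$-regular subgroup of order $n\in\{1,2,3,\dots\}\cup\{\infty\}$. Then \[ \bar b_1^\psi(G)-b_0^\psi(G)\le \bar b_1^\psi(H)+\frac{3+2\operatorname{Re}\psi(a)}{n+2+2\operatorname{Re}\psi(a)}, \] where the fraction is $0$ for $n=\infty$. In particular, $\bar b_1^\psi(G)\le\bar b_1^\psi(H)$ when $n=\infty$. -/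

import Mathlib

open Filter
open scoped ComplexConjugate

noncomputable section

/-- A (normalised) character of a group: a function `G → ℂ` of positive type which is constant on
conjugacy classes and takes the value `1` at the identity. -/
structure GroupCharacter (G : Type*) [Group G] where
  toFun : G → ℂ
  /-- Positive type: `∑ i j, cᵢ * conj cⱼ * ψ (gⱼ⁻¹ gᵢ)` is real and nonnegative. -/
  pos_type : ∀ (n : ℕ) (g : Fin n → G) (c : Fin n → ℂ),
    0 ≤ (∑ i, ∑ j, c i * conj (c j) * toFun ((g j)⁻¹ * g i)).re ∧
      (∑ i, ∑ j, c i * conj (c j) * toFun ((g j)⁻¹ * g i)).im = 0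
  conj_inv : ∀ g h : G, toFun (h * g * h⁻¹) = toFun g
  map_one : toFun 1 = 1

namespace GroupCharacter

variable {G : Type*} [Group G]

instance : CoeFun (GroupCharacter G) (fun _ => G → ℂ) := ⟨toFun⟩

/-- The restriction of a character to a subgroup. -/
def restrict (ψ : GroupCharacter G) (L : Subgroup G) : GroupCharacter L where
  toFun x := ψ x
  pos_type n g c := by simpa using ψ.pos_type n (fun i => (g i : G)) c
  conj_inv g h := by simpa using ψ.conj_inv (g : G) (h : G)
  map_one := by simpa using ψ.map_one

/-- A subgroup `K` is `ψ`-regular if `ψ` vanishes on `K \ {1}`. -/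
def IsRegular (ψ : GroupCharacter G) (K : Subgroup G) : Prop :=
  ∀ k ∈ K, k ≠ 1 → ψ k = 0

theorem map_inv (ψ : GroupCharacter G) (g : G) : ψ g⁻¹ = conj (ψ g) := by
  have h1 := (ψ.pos_type 2 ![1, g] ![1, 1]).2
  have h2 := (ψ.pos_type 2 ![1, g] ![1, Complex.I]).2
  simp [Fin.sum_univ_two, ψ.map_one] at h1 h2
  apply Complex.ext
  · simp; linarith
  · simp; linarith

/-! ### The Hilbert space `ℓ^ψ(G)` -/

set_option linter.unusedVariables false in
/-- The vector space underlying the group ring `ℂ[G]`, to be equipped with the semi-definite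
inner product given by `ψ`. -/
@[nolint unusedArguments]
def Pre (ψ : GroupCharacter G) : Type _ := G →₀ ℂ

instance (ψ : GroupCharacter G) : AddCommGroup ψ.Pre := inferInstanceAs (AddCommGroup (G →₀ ℂ))
instance (ψ : GroupCharacter G) : Module ℂ ψ.Pre := inferInstanceAs (Module ℂ (G →₀ ℂ))

/-- The identity, as a linear equivalence onto the type synonym. -/
def toPre (ψ : GroupCharacter G) : (G →₀ ℂ) ≃ₗ[ℂ] ψ.Pre := LinearEquiv.refl ℂ _

/-- The form on `ℂ[G]` with `form ψ h g = ψ (h⁻¹ * g)` on group elements, conjugate linear in the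
first and linear in the second variable. (Mathlib's inner products are conjugate linear in the
first variable, so this is `⟨y, x⟩_ψ` in the convention `⟨g, h⟩_ψ = ψ (h⁻¹ g)`.) -/
def form (ψ : GroupCharacter G) (x y : G →₀ ℂ) : ℂ :=
  x.sum fun h a => y.sum fun g b => conj a * b * ψ (h⁻¹ * g)

theorem form_add_left (ψ : GroupCharacter G) (x y z : G →₀ ℂ) :
    ψ.form (x + y) z = ψ.form x z + ψ.form y z := by
  unfold form
  refine Finsupp.sum_add_index' ?_ ?_
  · intro h; simp
  · intro h a b
    rw [← Finsupp.sum_add]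
    refine Finsupp.sum_congr fun g _ => ?_
    simp; ring

theorem form_smul_left (ψ : GroupCharacter G) (x y : G →₀ ℂ) (r : ℂ) :
    ψ.form (r • x) y = conj r * ψ.form x y := by
  unfold form
  rw [Finsupp.sum_smul_index (by intro h; simp), Finsupp.mul_sum]
  refine Finsupp.sum_congr fun h _ => ?_
  rw [Finsupp.mul_sum]
  refine Finsupp.sum_congr fun g _ => ?_
  rw [map_mul]; ring

theorem form_conj_symm (ψ : GroupCharacter G) (x y : G →₀ ℂ) :
    conj (ψ.form y x) = ψ.form x y := by
  unfold form Finsupp.sum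
  rw [map_sum, Finset.sum_congr rfl fun h _ => map_sum _ _ _, Finset.sum_comm]
  refine Finset.sum_congr rfl fun h _ => Finset.sum_congr rfl fun g _ => ?_
  rw [map_mul, map_mul, ← ψ.map_inv, mul_inv_rev, inv_inv, Complex.conj_conj]
  ring

theorem form_self_nonneg (ψ : GroupCharacter G) (x : G →₀ ℂ) : 0 ≤ (ψ.form x x).re := by
  let e := x.support.equivFin.symm
  have h := (ψ.pos_type x.support.card (fun i => (e i : G)) (fun i => x (e i))).1
  have key : (∑ i, ∑ j, x (e i) * conj (x (e j)) * ψ ((e j : G)⁻¹ * (e i : G))) = ψ.form x x := by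
    unfold form Finsupp.sum
    rw [Finset.sum_comm, ← Finset.sum_coe_sort x.support, ← e.sum_comp]
    refine Finset.sum_congr rfl fun j _ => ?_
    beta_reduce
    rw [← Finset.sum_coe_sort x.support, ← e.sum_comp]
    refine Finset.sum_congr rfl fun i _ => ?_
    ring
  rw [← key]
  exact h

theorem form_mapDomain_right (ψ : GroupCharacter G) (g : G) (x y : G →₀ ℂ) :
    ψ.form (Finsupp.mapDomain (fun h : G => h * g) x)
      (Finsupp.mapDomain (fun h : G => h * g) y) = ψ.form x y := by
  unfold form
  rw [Finsupp.sum_mapDomain_index (by intro h; simp)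
    (by intro h a b; rw [← Finsupp.sum_add]; refine Finsupp.sum_congr fun k _ => ?_
        rw [map_add]; ring)]
  refine Finsupp.sum_congr fun h _ => ?_
  rw [Finsupp.sum_mapDomain_index (by intro k; simp) (by intro k a b; ring)]
  refine Finsupp.sum_congr fun k _ => ?_
  have e : (h * g)⁻¹ * (k * g) = g⁻¹ * (h⁻¹ * k) * g⁻¹⁻¹ := by group
  rw [e, ψ.conj_inv]

/-- The semi-definite inner product on `ℂ[G]` given by `ψ`. -/
abbrev preCore (ψ : GroupCharacter G) : PreInnerProductSpace.Core ℂ ψ.Pre where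
  inner x y := ψ.form x y
  conj_inner_symm x y := ψ.form_conj_symm x y
  re_inner_nonneg x := ψ.form_self_nonneg x
  add_left x y z := ψ.form_add_left x y z
  smul_left x y r := ψ.form_smul_left x y r

instance (ψ : GroupCharacter G) : SeminormedAddCommGroup ψ.Pre :=
  InnerProductSpace.Core.toSeminormedAddCommGroup (c := ψ.preCore)
instance (ψ : GroupCharacter G) : InnerProductSpace ℂ ψ.Pre :=
  InnerProductSpace.ofCore ψ.preCore

/-- The Hilbert space `ℓ^ψ(G)`: the completion of `ℂ[G]` for the inner product given by `ψ`. -/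
abbrev Ell (ψ : GroupCharacter G) : Type _ := UniformSpace.Completion ψ.Pre

/-- The image of a group element in `ℓ^ψ(G)`. -/
def delta (ψ : GroupCharacter G) (g : G) : ψ.Ell :=
  ((ψ.toPre (Finsupp.single g 1) : ψ.Pre) : ψ.Ell)

/-- Right translation by `g` on `ℂ[G]`, as an isometry. -/
def preRight (ψ : GroupCharacter G) (g : G) : ψ.Pre →ₗᵢ[ℂ] ψ.Pre :=
  LinearMap.isometryOfInner
    (ψ.toPre.toLinearMap ∘ₗ Finsupp.lmapDomain ℂ ℂ (fun h : G => h * g) ∘ₗ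
      ψ.toPre.symm.toLinearMap)
    (fun x y => ψ.form_mapDomain_right g x y)

/-- Right translation by `g` on `ℓ^ψ(G)`. -/
def right (ψ : GroupCharacter G) (g : G) : ψ.Ell →L[ℂ] ψ.Ell :=
  (ψ.preRight g).toContinuousLinearMap.completion

/-- The right action `ξ ↦ ξ · z` of `z ∈ ℂ[G]` on `ℓ^ψ(G)`. -/
def rightRing (ψ : GroupCharacter G) (z : MonoidAlgebra ℂ G) : ψ.Ell →L[ℂ] ψ.Ell :=
  z.coeff.sum fun g c => c • ψ.right g

/-! ### The von Neumann dimension -/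

/-- For a family `e` of vectors in a Hilbert space `E`, the number `∑ i, ⟨P eᵢ, eᵢ⟩` where `P` is
the orthogonal projection onto the closure of `V`. It is used for `E = ℓ^ψ(G)^ι` and the
standard basis `e` of the free module, where it is the `ψ`-dimension of the (left invariant)
closed subspace `V`. -/
def traceDim {ι E : Type*} [Fintype ι] [NormedAddCommGroup E] [InnerProductSpace ℂ E]
    [CompleteSpace E] (e : ι → E) (V : Submodule ℂ E) : ℝ :=
  ∑ i, (inner ℂ (V.topologicalClosure.starProjection (e i)) (e i)).re

/-- The `ψ`-dimension of a left invariant subspace of `ℓ^ψ(G)`. -/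
def dimOne (ψ : GroupCharacter G) (V : Submodule ℂ ψ.Ell) : ℝ :=
  traceDim (fun _ : Unit => ψ.delta 1) V

/-- The Hilbert space `ℓ^ψ(G)^S` for a finite set `S`. -/
abbrev EllPow (ψ : GroupCharacter G) (S : Finset G) : Type _ := PiLp 2 fun _ : S => ψ.Ell

/-- The `ψ`-dimension of a left invariant subspace of `ℓ^ψ(G)^S`; the basis vector of index `s`
is the edge `(1, s)` of the Cayley graph. -/
def dimPow (ψ : GroupCharacter G) (S : Finset G) (V : Submodule ℂ (ψ.EllPow S)) : ℝ :=
  open scoped Classical in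
  traceDim (fun s : S => (WithLp.toLp 2 (Pi.single s (ψ.delta 1)) : ψ.EllPow S)) V

/-! ### Betti numbers

For a generating set `S` of `G` there is an exact sequence of free left `ℂ[G]`-modules
`F₂ → ℂ[G]^S → ℂ[G] → ℂ → 0` whose map `∂₁` sends the basis element of index `s` to `s - 1`, and
where `F₂` is free on the set `ker ∂₁` with its tautological map `∂₂`. The Betti numbers are the
dimensions of the reduced homology of the complex obtained by tensoring with `ℓ^ψ(G)`;
reduced homology `ker ∂ / closure (im ∂)` is realised as the orthogonal complement
of `im ∂` in `ker ∂`. -/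

/-- The zeroth Betti number `b₀^ψ(G)`, defined for all groups: the dimension of the orthogonal
complement of the image of `∂₁`, here for the generating set `G` itself. -/
def bettiZero (ψ : GroupCharacter G) : ℝ :=
  ψ.dimOne (Submodule.span ℂ {x | ∃ (g : G) (ξ : ψ.Ell), x = ψ.right g ξ - ξ})ᗮ

/-- `∂₁` on the group ring: `(z_s) ↦ ∑ z_s (s - 1)`. -/
def boundaryRing (S : Finset G) (z : S → MonoidAlgebra ℂ G) : MonoidAlgebra ℂ G :=
  ∑ s : S, z s * (MonoidAlgebra.single (s : G) 1 - 1)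

/-- `∂₁` after tensoring with `ℓ^ψ(G)`: `(ξ_s) ↦ ∑ (ξ_s s - ξ_s)`. -/
def boundary (ψ : GroupCharacter G) (S : Finset G) : ψ.EllPow S →ₗ[ℂ] ψ.Ell where
  toFun ξ := ∑ s : S, (ψ.right (s : G) (ξ s) - ξ s)
  map_add' ξ η := by
    rw [← Finset.sum_add_distrib]
    refine Finset.sum_congr rfl fun s _ => ?_
    simp only [PiLp.add_apply, map_add]; abel
  map_smul' c ξ := by
    rw [Finset.smul_sum]
    refine Finset.sum_congr rfl fun s _ => ?_
    simp [smul_sub]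

/-- The image of `∂₂` after tensoring with `ℓ^ψ(G)`: it is spanned by the elements
`ξ · z = (ξ z_s)_s` with `ξ ∈ ℓ^ψ(G)` and `z ∈ ker ∂₁`. -/
def boundaries (ψ : GroupCharacter G) (S : Finset G) : Submodule ℂ (ψ.EllPow S) :=
  Submodule.span ℂ {x | ∃ (ξ : ψ.Ell) (z : S → MonoidAlgebra ℂ G), boundaryRing S z = 0 ∧
    x = WithLp.toLp 2 fun s => ψ.rightRing (z s) ξ}

/-- The first Betti number computed with the finite generating set `S`. -/
def bettiOneOf (ψ : GroupCharacter G) (S : Finset G) : ℝ :=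
  ψ.dimPow S (LinearMap.ker (ψ.boundary S) ⊓ (ψ.boundaries S)ᗮ)

/-- The first Betti number `b₁^ψ(G)` of a finitely generated group, computed with some finite
generating set (the value is the same for all of them, by homotopy invariance). -/
def bettiOne (ψ : GroupCharacter G) [hG : Group.FG G] : ℝ :=
  ψ.bettiOneOf (Classical.choose hG.out)

/-- `b̄₁^ψ(G) = liminf b₁^ψ(L)` over the directed system of all finitely generated subgroups `L`
of `G`. The value may be `+∞`. -/
def bettiOneBar (ψ : GroupCharacter G) : EReal :=
  liminf (fun L : {L : Subgroup G // L.FG} =>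
    haveI : Group.FG L.1 := (Group.fg_iff_subgroup_fg L.1).2 L.2
    (((ψ.restrict L.1).bettiOne : ℝ) : EReal)) atTop

end GroupCharacter

end

noncomputable section

namespace GroupCharacter

variable {G Γ : Type*} [Group G] [Group Γ]

/-! ### Group elements in `ℓ^ψ(G)` -/

/-! The proof counts cocycles. For a finite generating set `S`, the orthogonal complement `Z` of the
image of `∂₂` is the space of 1-cocycles with values in `ℓ^ψ(G)`, recorded by their values on `S`,
and `b₁ - b₀ = dim Z - 1` (`bettiOneOf_eq`). Taking coefficients in the larger group does not change
the dimension of the cocycles of a subgroup (`trace_cocycles_map`).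

Let `G = ⟨L, a⟩` be finitely generated, with `L` finitely generated. Restriction sends cocycles of
`G` to cocycles of `L`. A cocycle `c` in its kernel is determined by `c a`. If `k` and `a⁻¹ka` both
lie in `L`, computing `c (k a) = c (a · a⁻¹ka)` in two ways shows that `c a` is fixed by translation
by `k`. If this holds on a finite set `F` of elements orthogonal in `ℓ^ψ(G)`, the fixed vectors have
dimension at most `1/|F|` by Bessel's inequality (`re_inner_fixed_le`). Hence `dim Z(G) ≤ dim Z(L) +
1/|F|`, so `b₁(G) - b₀(G) ≤ b₁(L) + 1/|F|` (`bettiOneOf_adjoin_le`).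

For general `G`, the subgroups `⟨L, a⟩` with `L ≤ H` finitely generated are cofinal, and `b₀`
converges along finitely generated subgroups, which yields the inequality for the lower limits
(`bettiOneBar_adjoin_le`). The bound `1/n` obtained with `F = K` is at least as strong as the stated
fraction because `Re ψ(a) ≥ -1`; for infinite `K` arbitrarily large `F` are used.

The dimension calculus rests on traciality (`inner_comp_comm`) and a rank theorem
(`trace_starProjection_ker`), which is deduced from the mean ergodic theorem. -/

theorem inner_coe_eq_form (ψ : GroupCharacter G) (x y : G →₀ ℂ) :
    inner ℂ ((ψ.toPre x : ψ.Pre) : ψ.Ell) ((ψ.toPre y : ψ.Pre) : ψ.Ell) = ψ.form x y :=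
  UniformSpace.Completion.inner_coe _ _

theorem form_single (ψ : GroupCharacter G) (g h : G) (a b : ℂ) :
    ψ.form (Finsupp.single g a) (Finsupp.single h b) = conj a * b * ψ (g⁻¹ * h) := by
  unfold form
  rw [Finsupp.sum_single_index (by simp), Finsupp.sum_single_index (by simp)]

theorem inner_delta (ψ : GroupCharacter G) (g h : G) :
    inner ℂ (ψ.delta g) (ψ.delta h) = ψ (g⁻¹ * h) := by
  unfold delta
  rw [inner_coe_eq_form, form_single]
  simp

theorem norm_delta (ψ : GroupCharacter G) (g : G) : ‖ψ.delta g‖ = 1 := by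
  have h : ‖ψ.delta g‖ ^ 2 = 1 := by
    rw [← inner_self_eq_norm_sq (𝕜 := ℂ), inner_delta]
    simp [ψ.map_one]
  nlinarith [norm_nonneg (ψ.delta g)]

theorem coe_toPre_single (ψ : GroupCharacter G) (g : G) (c : ℂ) :
    ((ψ.toPre (Finsupp.single g c) : ψ.Pre) : ψ.Ell) = c • ψ.delta g := by
  unfold delta
  rw [← UniformSpace.Completion.coe_smul, ← map_smul, Finsupp.smul_single_one]

theorem ell_induction (ψ : GroupCharacter G) {p : ψ.Ell → Prop} (hp : IsClosed {x | p x})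
    (hdelta : ∀ g, p (ψ.delta g)) (hadd : ∀ x y, p x → p y → p (x + y))
    (hsmul : ∀ (c : ℂ) x, p x → p (c • x)) (x : ψ.Ell) : p x := by
  refine UniformSpace.Completion.induction_on x hp fun y => ?_
  obtain ⟨z, rfl⟩ := ψ.toPre.surjective y
  induction z using Finsupp.induction_linear with
  | zero =>
    rw [map_zero, UniformSpace.Completion.coe_zero, ← zero_smul ℂ (ψ.delta 1)]
    exact hsmul _ _ (hdelta 1)
  | add f g hf hg =>
    rw [map_add, UniformSpace.Completion.coe_add]
    exact hadd _ _ hf hg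
  | single g c =>
    rw [coe_toPre_single]
    exact hsmul _ _ (hdelta g)

theorem ell_ext (ψ : GroupCharacter G) {x y : ψ.Ell}
    (h : ∀ g, inner ℂ (ψ.delta g) x = inner ℂ (ψ.delta g) y) : x = y := by
  refine ext_inner_left ℂ fun v => ?_
  refine ψ.ell_induction (p := fun v => inner ℂ v x = inner ℂ v y)
    (isClosed_eq (by fun_prop) (by fun_prop)) h ?_ ?_ v
  · intro a b ha hb; rw [inner_add_left, inner_add_left, ha, hb]
  · intro c a ha; rw [inner_smul_left, inner_smul_left, ha]

theorem clm_ext (ψ : GroupCharacter G) {F : Type*} [NormedAddCommGroup F] [NormedSpace ℂ F]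
    {S T : ψ.Ell →L[ℂ] F} (h : ∀ g, S (ψ.delta g) = T (ψ.delta g)) : S = T := by
  ext x
  refine ψ.ell_induction (p := fun x => S x = T x)
    (isClosed_eq (by fun_prop) (by fun_prop)) h ?_ ?_ x
  · intro a b ha hb; rw [map_add, map_add, ha, hb]
  · intro c a ha; rw [map_smul, map_smul, ha]

/-! ### Maps induced by maps of group elements -/

section MapEll

variable (χ : GroupCharacter Γ) (ψ : GroupCharacter G)

/-- The form depends on a pair only through `x⁻¹y`, so one criterion covers left translations, right
translations (where `ψ` is a class function) and homomorphisms compatible with the characters. -/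
theorem form_mapDomain (f : Γ → G)
    (hf : ∀ x y, ψ ((f x)⁻¹ * f y) = χ (x⁻¹ * y)) (x y : Γ →₀ ℂ) :
    ψ.form (Finsupp.mapDomain f x) (Finsupp.mapDomain f y) = χ.form x y := by
  unfold form
  rw [Finsupp.sum_mapDomain_index (by intro h; simp)
    (by intro h a b; rw [← Finsupp.sum_add]; refine Finsupp.sum_congr fun k _ => ?_
        rw [map_add]; ring)]
  refine Finsupp.sum_congr fun h _ => ?_
  rw [Finsupp.sum_mapDomain_index (by intro k; simp) (by intro k a b; ring)]
  refine Finsupp.sum_congr fun k _ => ?_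
  rw [hf]

/-- The isometry of group rings induced by a map compatible with the two forms. -/
def preMap (f : Γ → G) (hf : ∀ x y, ψ ((f x)⁻¹ * f y) = χ (x⁻¹ * y)) : χ.Pre →ₗᵢ[ℂ] ψ.Pre :=
  LinearMap.isometryOfInner
    (ψ.toPre.toLinearMap ∘ₗ Finsupp.lmapDomain ℂ ℂ f ∘ₗ χ.toPre.symm.toLinearMap)
    (fun x y => form_mapDomain χ ψ f hf x y)

/-- The operator `ℓ^χ(Γ) → ℓ^ψ(G)` induced by a map compatible with the two forms. -/
def mapEll (f : Γ → G) (hf : ∀ x y, ψ ((f x)⁻¹ * f y) = χ (x⁻¹ * y)) : χ.Ell →L[ℂ] ψ.Ell :=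
  (preMap χ ψ f hf).toContinuousLinearMap.completion

theorem mapEll_delta (f : Γ → G) (hf : ∀ x y, ψ ((f x)⁻¹ * f y) = χ (x⁻¹ * y)) (g : Γ) :
    mapEll χ ψ f hf (χ.delta g) = ψ.delta (f g) := by
  unfold mapEll delta
  rw [ContinuousLinearMap.completion_apply_coe]
  congr 1
  change ψ.toPre (Finsupp.mapDomain f (Finsupp.single g 1)) = _
  rw [Finsupp.mapDomain_single]

theorem inner_mapEll (f : Γ → G) (hf : ∀ x y, ψ ((f x)⁻¹ * f y) = χ (x⁻¹ * y)) (x y : χ.Ell) :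
    inner ℂ (mapEll χ ψ f hf x) (mapEll χ ψ f hf y) = inner ℂ x y := by
  refine UniformSpace.Completion.induction_on₂ x y
    (isClosed_eq (by fun_prop) (by fun_prop)) fun a b => ?_
  unfold mapEll
  rw [ContinuousLinearMap.completion_apply_coe, ContinuousLinearMap.completion_apply_coe,
    UniformSpace.Completion.inner_coe, UniformSpace.Completion.inner_coe]
  exact (preMap χ ψ f hf).inner_map_map a b

end MapEll

variable (ψ : GroupCharacter G)

/-! ### Left and right translation -/

theorem right_eq_mapEll (g : G) :
    ∃ hf, ψ.right g = mapEll ψ ψ (fun h => h * g) hf := by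
  refine ⟨fun x y => ?_, rfl⟩
  have e : (x * g)⁻¹ * (y * g) = g⁻¹ * (x⁻¹ * y) * g⁻¹⁻¹ := by group
  rw [e, ψ.conj_inv]

theorem right_delta (g h : G) : ψ.right g (ψ.delta h) = ψ.delta (h * g) := by
  obtain ⟨hf, e⟩ := ψ.right_eq_mapEll g
  rw [e, mapEll_delta]

theorem inner_right_right (g : G) (x y : ψ.Ell) :
    inner ℂ (ψ.right g x) (ψ.right g y) = inner ℂ x y := by
  obtain ⟨hf, e⟩ := ψ.right_eq_mapEll g
  rw [e, inner_mapEll]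

theorem right_mul (g h : G) : ψ.right (g * h) = ψ.right h * ψ.right g :=
  ψ.clm_ext fun k => by simp [right_delta, mul_assoc]

theorem right_one : ψ.right 1 = 1 :=
  ψ.clm_ext fun k => by simp [right_delta]

theorem inner_right_left (g : G) (x y : ψ.Ell) :
    inner ℂ (ψ.right g x) y = inner ℂ x (ψ.right g⁻¹ y) := by
  rw [← ψ.inner_right_right g x]
  congr 1
  change y = (ψ.right g * ψ.right g⁻¹) y
  rw [← right_mul]
  simp [right_one]

/-- Left translation by `g` on `ℓ^ψ(G)`. -/
def left (g : G) : ψ.Ell →L[ℂ] ψ.Ell :=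
  mapEll ψ ψ (fun h => g * h) (fun x y => by congr 1; group)

theorem left_delta (g h : G) : ψ.left g (ψ.delta h) = ψ.delta (g * h) := mapEll_delta _ _ _ _ _

theorem left_mul (g h : G) : ψ.left (g * h) = ψ.left g * ψ.left h :=
  ψ.clm_ext fun k => by simp [left_delta, mul_assoc]

theorem left_one : ψ.left 1 = 1 :=
  ψ.clm_ext fun k => by simp [left_delta]

theorem inner_left_left (g : G) (x y : ψ.Ell) :
    inner ℂ (ψ.left g x) y = inner ℂ x (ψ.left g⁻¹ y) := by
  rw [← inner_mapEll ψ ψ (fun h => g * h) (fun x y => by congr 1; group) x]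
  congr 1
  change y = (ψ.left g * ψ.left g⁻¹) y
  rw [← left_mul]
  simp [left_one]

theorem left_right (g h : G) (x : ψ.Ell) :
    ψ.left g (ψ.right h x) = ψ.right h (ψ.left g x) := by
  have : ψ.left g * ψ.right h = ψ.right h * ψ.left g :=
    ψ.clm_ext fun k => by simp [right_delta, left_delta, mul_assoc]
  exact congrArg (fun T => T x) this

/-! ### The conjugation -/

theorem form_conj_inv (x y : G →₀ ℂ) :
    ψ.form (Finsupp.mapDomain Inv.inv (x.mapRange conj (map_zero _)))
      (Finsupp.mapDomain Inv.inv (y.mapRange conj (map_zero _))) = ψ.form y x := by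
  unfold form
  rw [Finsupp.sum_mapDomain_index (by intro h; simp)
    (by intro h a b; rw [← Finsupp.sum_add]; refine Finsupp.sum_congr fun k _ => ?_
        rw [map_add]; ring), Finsupp.sum_mapRange_index (by intro h; simp), Finsupp.sum_comm]
  rw [Finsupp.sum_mapDomain_index (by intro k; simp)
    (by intro k a b; rw [← Finsupp.sum_add]; refine Finsupp.sum_congr fun k _ => ?_; ring),
    Finsupp.sum_mapRange_index (by intro h; simp)]
  refine Finsupp.sum_congr fun h _ => Finsupp.sum_congr fun k _ => ?_
  have e : k⁻¹⁻¹ * h⁻¹ = h * (h⁻¹ * k) * h⁻¹ := by group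
  rw [e, ψ.conj_inv, Complex.conj_conj]
  ring

/-- The conjugate linear map on `ℂ[G]` with `g ↦ g⁻¹`. -/
def preConj : ψ.Pre →ₛₗ[starRingEnd ℂ] ψ.Pre where
  toFun x := ψ.toPre
    (Finsupp.mapDomain Inv.inv ((ψ.toPre.symm x).mapRange conj (map_zero _)))
  map_add' x y := by
    rw [map_add, Finsupp.mapRange_add (map_add _), Finsupp.mapDomain_add, map_add]
  map_smul' c x := by
    have h : ∀ z : G →₀ ℂ, (c • z).mapRange conj (map_zero _) =
        conj c • z.mapRange conj (map_zero _) := fun z => by ext; simp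
    rw [map_smul, h, Finsupp.mapDomain_smul, map_smul]

theorem norm_preConj (x : ψ.Pre) : ‖ψ.preConj x‖ = ‖x‖ := by
  have h : inner ℂ (ψ.preConj x) (ψ.preConj x) = inner ℂ x x := ψ.form_conj_inv _ _
  rw [inner_self_eq_norm_sq_to_K, inner_self_eq_norm_sq_to_K] at h
  have h' : ‖ψ.preConj x‖ ^ 2 = ‖x‖ ^ 2 := by exact_mod_cast h
  exact (sq_eq_sq₀ (norm_nonneg _) (norm_nonneg _)).1 h'

/-- The canonical conjugate linear isometry of `ℓ^ψ(G)`, with `g ↦ g⁻¹`. -/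
def conjEll : ψ.Ell →SL[starRingEnd ℂ] ψ.Ell :=
  (ψ.preConj.mkContinuous 1 fun x => by rw [norm_preConj, one_mul]).completion

theorem conjEll_delta (g : G) : ψ.conjEll (ψ.delta g) = ψ.delta g⁻¹ := by
  unfold conjEll delta
  rw [ContinuousLinearMap.completion_apply_coe]
  congr 1
  change ψ.toPre (Finsupp.mapDomain Inv.inv
    ((Finsupp.single g (1 : ℂ)).mapRange conj (map_zero _))) = _
  rw [Finsupp.mapRange_single, Finsupp.mapDomain_single, _root_.map_one]

theorem inner_conjEll (x y : ψ.Ell) :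
    inner ℂ y (ψ.conjEll x) = inner ℂ x (ψ.conjEll y) := by
  refine ψ.ell_induction (p := fun x => inner ℂ y (ψ.conjEll x) = inner ℂ x (ψ.conjEll y))
    (isClosed_eq (by fun_prop) (by fun_prop)) ?_ ?_ ?_ x
  · intro g
    refine ψ.ell_induction (p := fun y => inner ℂ y (ψ.conjEll (ψ.delta g)) =
      inner ℂ (ψ.delta g) (ψ.conjEll y)) (isClosed_eq (by fun_prop) (by fun_prop)) ?_ ?_ ?_ y
    · intro h
      rw [conjEll_delta, conjEll_delta, inner_delta, inner_delta]
      have e : g⁻¹ * h⁻¹ = h * (h⁻¹ * g⁻¹) * h⁻¹ := by group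
      rw [e, ψ.conj_inv]
    · intro a b ha hb; rw [inner_add_left, map_add, inner_add_right, ha, hb]
    · intro c a ha; rw [inner_smul_left, map_smulₛₗ, inner_smul_right, ha]
  · intro a b ha hb; rw [inner_add_left, map_add, inner_add_right, ha, hb]
  · intro c a ha; rw [inner_smul_left, map_smulₛₗ, inner_smul_right, ha]

/-- Such a `T` behaves like right convolution by `T δ₁`. Equivariance turns `⟨T δ_g, δ₁⟩` into `⟨T
δ₁, δ_{g⁻¹}⟩`, which identifies `T* δ₁` with the conjugate of `T δ₁`. -/
theorem adjoint_delta_one {T : ψ.Ell →L[ℂ] ψ.Ell}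
    (hT : ∀ g x, T (ψ.left g x) = ψ.left g (T x)) :
    ContinuousLinearMap.adjoint T (ψ.delta 1) = ψ.conjEll (T (ψ.delta 1)) := by
  refine ψ.ell_ext fun g => ?_
  rw [ContinuousLinearMap.adjoint_inner_right, inner_conjEll, conjEll_delta]
  have h : ψ.delta g = ψ.left g (ψ.delta 1) := by rw [left_delta, mul_one]
  rw [h, hT, inner_left_left, left_delta, mul_one]

/-- The vector state of `1` is tracial on the operators that commute with left translations. -/
theorem inner_comp_comm {S T : ψ.Ell →L[ℂ] ψ.Ell}
    (hS : ∀ g x, S (ψ.left g x) = ψ.left g (S x)) (hT : ∀ g x, T (ψ.left g x) = ψ.left g (T x)) :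
    inner ℂ (ψ.delta 1) (S (T (ψ.delta 1))) = inner ℂ (ψ.delta 1) (T (S (ψ.delta 1))) := by
  -- With `J` the conjugation, the two sides are `⟨J S δ₁, T δ₁⟩` and `⟨J T δ₁, S δ₁⟩`; the symmetry
  -- of `J` identifies them.
  rw [← ContinuousLinearMap.adjoint_inner_left S (T (ψ.delta 1)),
    ← ContinuousLinearMap.adjoint_inner_left T (S (ψ.delta 1)),
    ψ.adjoint_delta_one hS, ψ.adjoint_delta_one hT, ← inner_conj_symm, inner_conjEll,
    inner_conj_symm]

end GroupCharacter

/-! ### Orthogonal projections -/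

section Projection

variable {E F : Type*} [NormedAddCommGroup E] [InnerProductSpace ℂ E]
  [NormedAddCommGroup F] [InnerProductSpace ℂ F]

theorem IsClosed.hasOrthogonalProjection [CompleteSpace E] {V : Submodule ℂ E}
    (hV : IsClosed (V : Set E)) : V.HasOrthogonalProjection :=
  haveI := hV.completeSpace_coe
  inferInstance

/-- A map preserving inner products intertwines orthogonal projections if it respects the subspaces
and their orthogonal complements. -/
theorem Submodule.starProjection_map_of_inner (i : E →ₗ[ℂ] F) {V : Submodule ℂ E}
    {W : Submodule ℂ F} [V.HasOrthogonalProjection] [W.HasOrthogonalProjection]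
    (h₁ : ∀ x ∈ V, i x ∈ W) (h₂ : ∀ x ∈ Vᗮ, i x ∈ Wᗮ) (x : E) :
    W.starProjection (i x) = i (V.starProjection x) := by
  refine (Submodule.eq_starProjection_of_mem_orthogonal (h₁ _ (V.starProjection_apply_mem x)) ?_)
  rw [← map_sub]
  exact h₂ _ (V.sub_starProjection_mem_orthogonal x)

theorem Submodule.starProjection_eq_add {V X Y : Submodule ℂ E} [V.HasOrthogonalProjection]
    [X.HasOrthogonalProjection] [Y.HasOrthogonalProjection] (hX : X ≤ V) (hY : Y ≤ V)
    (hXY : ∀ x ∈ X, ∀ y ∈ Y, inner ℂ x y = 0) (hV : ∀ v ∈ V, ∃ x ∈ X, ∃ y ∈ Y, v = x + y)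
    (u : E) : V.starProjection u = X.starProjection u + Y.starProjection u := by
  refine Submodule.eq_starProjection_of_mem_of_inner_eq_zero
    (V.add_mem (hX (X.starProjection_apply_mem u)) (hY (Y.starProjection_apply_mem u))) ?_
  intro v hv
  obtain ⟨x, hx, y, hy, rfl⟩ := hV v hv
  have h1 := Submodule.starProjection_inner_eq_zero u x hx
  have h2 := Submodule.starProjection_inner_eq_zero u y hy
  have h3 := hXY _ (X.starProjection_apply_mem u) y hy
  have h4 : inner ℂ (Y.starProjection u) x = 0 := by
    rw [← inner_conj_symm, hXY x hx _ (Y.starProjection_apply_mem u), map_zero]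
  rw [inner_sub_left] at h1 h2
  rw [inner_sub_left, inner_add_left, inner_add_right, inner_add_right, inner_add_right]
  linear_combination h1 + h2 - h3 - h4

/-- `⟨P u, u⟩ = ‖P u‖²` for a projection, and `P_V = P_V P_W` when `V ≤ W`. -/
theorem Submodule.re_inner_starProjection_mono {V W : Submodule ℂ E} [V.HasOrthogonalProjection]
    [W.HasOrthogonalProjection] (h : V ≤ W) (u : E) :
    (inner ℂ (V.starProjection u) u).re ≤ (inner ℂ (W.starProjection u) u).re := by
  have h1 : ∀ (U : Submodule ℂ E) [U.HasOrthogonalProjection],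
      (inner ℂ (U.starProjection u) u).re = ‖U.starProjection u‖ ^ 2 := by
    intro U _
    exact Submodule.re_inner_starProjection_eq_normSq U u
  rw [h1, h1, ← Submodule.starProjection_comp_starProjection_of_le h]
  gcongr
  exact V.norm_starProjection_apply_le _

theorem GroupCharacter.traceDim_eq [CompleteSpace E] {ι : Type*} [Fintype ι] (e : ι → E)
    (V : Submodule ℂ E) [V.HasOrthogonalProjection] :
    GroupCharacter.traceDim e V = ∑ i, (inner ℂ (V.starProjection (e i)) (e i)).re := by
  unfold GroupCharacter.traceDim
  refine Finset.sum_congr rfl fun i _ => ?_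
  congr 2
  refine Submodule.eq_starProjection_of_mem_orthogonal
    (V.le_topologicalClosure (V.starProjection_apply_mem _)) ?_
  rw [Submodule.orthogonal_closure]
  exact V.sub_starProjection_mem_orthogonal _

end Projection

namespace GroupCharacter

variable {G Γ : Type*} [Group G] [Group Γ] {ι κ l : Type*} [Fintype ι] [Fintype κ] [Fintype l]

/-- The Hilbert space `ℓ^ψ(G)^ι`. -/
abbrev EllFun (ψ : GroupCharacter G) (ι : Type*) [Fintype ι] : Type _ :=
  PiLp 2 fun _ : ι => ψ.Ell

/-! ### Matrices of operators and left equivariance -/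

section Operators

variable (χ : GroupCharacter Γ) (ψ : GroupCharacter G)

/-- The operator given by a matrix of operators. -/
def ofMatrix (T : κ → ι → ψ.Ell →L[ℂ] ψ.Ell) : ψ.EllFun ι →L[ℂ] ψ.EllFun κ :=
  (PiLp.continuousLinearEquiv 2 ℂ (fun _ : κ => ψ.Ell)).symm.toContinuousLinearMap ∘L
    ContinuousLinearMap.pi fun k => ∑ i, T k i ∘L PiLp.proj 2 (fun _ : ι => ψ.Ell) i

@[simp]
theorem ofMatrix_apply (T : κ → ι → ψ.Ell →L[ℂ] ψ.Ell) (η : ψ.EllFun ι) (k : κ) :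
    ψ.ofMatrix T η k = ∑ i, T k i (η i) := by
  change (∑ i, T k i ∘L PiLp.proj 2 (fun _ : ι => ψ.Ell) i) η = _
  rw [_root_.sum_apply]
  rfl

variable {χ ψ} in
/-- An operator applied in each coordinate. -/
def coordwise (ι : Type*) [Fintype ι] (T : χ.Ell →L[ℂ] ψ.Ell) : χ.EllFun ι →L[ℂ] ψ.EllFun ι :=
  (PiLp.continuousLinearEquiv 2 ℂ (fun _ : ι => ψ.Ell)).symm.toContinuousLinearMap ∘L
    ContinuousLinearMap.pi fun i => T ∘L PiLp.proj 2 (fun _ : ι => χ.Ell) i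

@[simp]
theorem coordwise_apply (T : χ.Ell →L[ℂ] ψ.Ell) (η : χ.EllFun ι) (i : ι) :
    coordwise ι T η i = T (η i) := rfl

/-- The inclusion of a coordinate. -/
def incl (i : ι) : ψ.Ell →L[ℂ] ψ.EllFun ι :=
  open scoped Classical in
  (PiLp.continuousLinearEquiv 2 ℂ (fun _ : ι => ψ.Ell)).symm.toContinuousLinearMap ∘L
    ContinuousLinearMap.single ℂ (fun _ : ι => ψ.Ell) i

theorem incl_apply [DecidableEq ι] (i : ι) (x : ψ.Ell) :
    ψ.incl i x = WithLp.toLp 2 (Pi.single i x) := by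
  change WithLp.toLp 2 (@Pi.single ι (fun _ => ψ.Ell) _
    (fun a b => Classical.propDecidable (a = b)) i x) = _
  congr!

theorem sum_incl (η : ψ.EllFun ι) : ∑ i, ψ.incl i (η i) = η := by
  classical
  ext j
  simp [incl_apply, Finset.sum_apply, Pi.single_apply]

theorem inner_incl (η : ψ.EllFun ι) (i : ι) (x : ψ.Ell) :
    inner ℂ (ψ.incl i x) η = inner ℂ x (η i) := by
  classical
  rw [PiLp.inner_apply, Finset.sum_eq_single i]
  · simp [incl_apply]
  · intro j _ hj
    simp [incl_apply, hj]
  · simp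

/-- The operator commutes with left translations. -/
def LeftEquivariant {ψ : GroupCharacter G} (T : ψ.EllFun ι →L[ℂ] ψ.EllFun κ) : Prop :=
  ∀ g x, T (coordwise ι (ψ.left g) x) = coordwise κ (ψ.left g) (T x)

/-- The subspace is invariant under left translations. -/
def LeftInvariant {ψ : GroupCharacter G} (V : Submodule ℂ (ψ.EllFun ι)) : Prop :=
  ∀ g, ∀ x ∈ V, coordwise ι (ψ.left g) x ∈ V

theorem coordwise_incl (g : G) (i : ι) (x : ψ.Ell) :
    coordwise ι (ψ.left g) (ψ.incl i x) = ψ.incl i (ψ.left g x) := by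
  classical
  ext j
  by_cases h : j = i
  · subst h; simp [incl_apply]
  · simp [incl_apply, h]

variable {χ ψ}

theorem inner_coordwise_left (g : G) (x y : ψ.EllFun ι) :
    inner ℂ (coordwise ι (ψ.left g) x) y = inner ℂ x (coordwise ι (ψ.left g⁻¹) y) := by
  simp only [PiLp.inner_apply, coordwise_apply, inner_left_left]

theorem LeftEquivariant.comp {S : ψ.EllFun κ →L[ℂ] ψ.EllFun l} {T : ψ.EllFun ι →L[ℂ] ψ.EllFun κ}
    (hS : LeftEquivariant S) (hT : LeftEquivariant T) : LeftEquivariant (S ∘L T) := by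
  intro g x
  simp only [ContinuousLinearMap.comp_apply, hT g, hS g]

theorem LeftEquivariant.sub {S T : ψ.EllFun ι →L[ℂ] ψ.EllFun κ}
    (hS : LeftEquivariant S) (hT : LeftEquivariant T) : LeftEquivariant (S - T) := by
  intro g x
  simp only [_root_.sub_apply, hT g, hS g, map_sub]

theorem LeftEquivariant.smul {T : ψ.EllFun ι →L[ℂ] ψ.EllFun κ} (c : ℂ)
    (hT : LeftEquivariant T) : LeftEquivariant (c • T) := by
  intro g x
  simp only [_root_.smul_apply, hT g, map_smul]

theorem LeftEquivariant.sum {T : ℕ → ψ.EllFun ι →L[ℂ] ψ.EllFun κ}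
    (hT : ∀ k, LeftEquivariant (T k)) (n : ℕ) :
    LeftEquivariant (∑ k ∈ Finset.range n, T k) := by
  intro g x
  simp only [_root_.sum_apply, hT _ g, map_sum]

theorem leftEquivariant_one : LeftEquivariant (1 : ψ.EllFun ι →L[ℂ] ψ.EllFun ι) :=
  fun _ _ => rfl

theorem LeftEquivariant.pow {T : ψ.EllFun ι →L[ℂ] ψ.EllFun ι}
    (hT : LeftEquivariant T) (n : ℕ) : LeftEquivariant (T ^ n) := by
  induction n with
  | zero => exact leftEquivariant_one
  | succ n ih => rw [pow_succ]; exact ih.comp hT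

theorem LeftEquivariant.adjoint {T : ψ.EllFun ι →L[ℂ] ψ.EllFun κ}
    (hT : LeftEquivariant T) : LeftEquivariant (ContinuousLinearMap.adjoint T) := by
  intro g x
  refine ext_inner_right ℂ fun y => ?_
  rw [ContinuousLinearMap.adjoint_inner_left, inner_coordwise_left, ← hT, inner_coordwise_left,
    ContinuousLinearMap.adjoint_inner_left]

theorem LeftInvariant.starProjection {V : Submodule ℂ (ψ.EllFun ι)} [V.HasOrthogonalProjection]
    (hV : LeftInvariant V) : LeftEquivariant V.starProjection := by
  intro g x
  refine Submodule.eq_starProjection_of_mem_of_inner_eq_zero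
    (hV g _ (V.starProjection_apply_mem x)) fun w hw => ?_
  rw [← map_sub, inner_coordwise_left]
  exact Submodule.starProjection_inner_eq_zero x _ (hV _ _ hw)

theorem LeftInvariant.orthogonal {V : Submodule ℂ (ψ.EllFun ι)}
    (hV : LeftInvariant V) : LeftInvariant Vᗮ := by
  intro g x hx
  rw [Submodule.mem_orthogonal'] at hx ⊢
  intro u hu
  rw [inner_coordwise_left]
  exact hx _ (hV _ _ hu)

theorem LeftInvariant.inf {V W : Submodule ℂ (ψ.EllFun ι)}
    (hV : LeftInvariant V) (hW : LeftInvariant W) : LeftInvariant (V ⊓ W) :=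
  fun g x hx => ⟨hV g x hx.1, hW g x hx.2⟩

theorem LeftInvariant.of_forall_mem_iff {V : Submodule ℂ (ψ.EllFun ι)}
    {T : ψ.EllFun ι →L[ℂ] ψ.EllFun κ} (hT : LeftEquivariant T) (hV : ∀ x, x ∈ V ↔ T x = 0) :
    LeftInvariant V := by
  intro g x hx
  rw [hV] at hx ⊢
  rw [hT, hx, map_zero]

theorem leftEquivariant_ofMatrix {T : κ → ι → ψ.Ell →L[ℂ] ψ.Ell}
    (hT : ∀ k i g x, T k i (ψ.left g x) = ψ.left g (T k i x)) :
    LeftEquivariant (ψ.ofMatrix T) := by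
  intro g x
  ext k
  simp [hT]

/-! ### The trace -/

/-- The trace of an operator on `ℓ^ψ(G)^ι`. -/
def trace (T : ψ.EllFun ι →L[ℂ] ψ.EllFun ι) : ℝ :=
  ∑ i, (inner ℂ (T (ψ.incl i (ψ.delta 1))) (ψ.incl i (ψ.delta 1))).re

theorem trace_eq_sum (T : ψ.EllFun ι →L[ℂ] ψ.EllFun ι) :
    trace T = ∑ i, (inner ℂ (ψ.delta 1) (T (ψ.incl i (ψ.delta 1)) i)).re := by
  unfold trace
  refine Finset.sum_congr rfl fun i _ => ?_
  rw [← inner_conj_symm, inner_incl, Complex.conj_re]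

theorem trace_sub (S T : ψ.EllFun ι →L[ℂ] ψ.EllFun ι) : trace (S - T) = trace S - trace T := by
  simp [trace]

theorem trace_add (S T : ψ.EllFun ι →L[ℂ] ψ.EllFun ι) : trace (S + T) = trace S + trace T := by
  simp [trace, Finset.sum_add_distrib]

theorem trace_one : trace (1 : ψ.EllFun ι →L[ℂ] ψ.EllFun ι) = Fintype.card ι := by
  classical
  rw [trace_eq_sum]
  simp [incl_apply, norm_delta]

theorem trace_comp (A : ψ.EllFun ι →L[ℂ] ψ.EllFun κ) (B : ψ.EllFun κ →L[ℂ] ψ.EllFun ι) :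
    trace (B ∘L A) = ∑ i, ∑ k, (inner ℂ (ψ.delta 1)
      (B (ψ.incl k (A (ψ.incl i (ψ.delta 1)) k)) i)).re := by
  rw [trace_eq_sum]
  refine Finset.sum_congr rfl fun i _ => ?_
  rw [ContinuousLinearMap.comp_apply]
  nth_rw 1 [← ψ.sum_incl (A _)]
  rw [map_sum, WithLp.ofLp_sum, Finset.sum_apply, inner_sum, Complex.re_sum]

theorem LeftEquivariant.exists_entry {A : ψ.EllFun ι →L[ℂ] ψ.EllFun κ} (hA : LeftEquivariant A)
    (i : ι) (k : κ) : ∃ T : ψ.Ell →L[ℂ] ψ.Ell,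
      (∀ x, T x = A (ψ.incl i x) k) ∧ ∀ g x, T (ψ.left g x) = ψ.left g (T x) := by
  refine ⟨PiLp.proj 2 (fun _ : κ => ψ.Ell) k ∘L A ∘L ψ.incl i, fun x => rfl, fun g x => ?_⟩
  change A (ψ.incl i (ψ.left g x)) k = ψ.left g (A (ψ.incl i x) k)
  rw [← coordwise_incl, hA, coordwise_apply]

/-- Each matrix entry commutes with left translations, so the scalar identity `inner_comp_comm`
applies to every pair of entries. -/
theorem trace_comm {A : ψ.EllFun ι →L[ℂ] ψ.EllFun κ} {B : ψ.EllFun κ →L[ℂ] ψ.EllFun ι}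
    (hA : LeftEquivariant A) (hB : LeftEquivariant B) : trace (B ∘L A) = trace (A ∘L B) := by
  rw [trace_comp, trace_comp, Finset.sum_comm]
  refine Finset.sum_congr rfl fun k _ => Finset.sum_congr rfl fun i _ => ?_
  obtain ⟨S, hS, hS'⟩ := hA.exists_entry i k
  obtain ⟨T, hT, hT'⟩ := hB.exists_entry k i
  rw [← hS, ← hT, ← hT, ← hS, ψ.inner_comp_comm hT' hS']

end Operators

end GroupCharacter

namespace GroupCharacter

variable {G : Type*} [Group G] {ι κ : Type*} [Fintype ι] [Fintype κ]
variable {ψ : GroupCharacter G}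

/-! ### Dimensions of kernels -/

/-- Expand `‖x - T*Tx‖² = ‖x‖² - 2‖Tx‖² + ‖T*Tx‖²` and use `‖T*Tx‖ ≤ ‖Tx‖`. Contractivity is what
the mean ergodic theorem requires. -/
theorem norm_one_sub_adjoint_comp_le {T : ψ.EllFun ι →L[ℂ] ψ.EllFun κ} (hT : ‖T‖ ≤ 1) :
    ‖(1 : ψ.EllFun ι →L[ℂ] ψ.EllFun ι) - ContinuousLinearMap.adjoint T ∘L T‖ ≤ 1 := by
  refine ContinuousLinearMap.opNorm_le_bound _ zero_le_one fun x => ?_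
  rw [one_mul]
  refine (sq_le_sq₀ (norm_nonneg _) (norm_nonneg _)).1 ?_
  have h1 : ‖ContinuousLinearMap.adjoint T (T x)‖ ≤ ‖T x‖ := by
    have := (ContinuousLinearMap.adjoint T).le_opNorm (T x)
    rw [LinearIsometryEquiv.norm_map] at this
    nlinarith [norm_nonneg (T x)]
  have h2 := norm_sub_sq (𝕜 := ℂ) x (ContinuousLinearMap.adjoint T (T x))
  rw [ContinuousLinearMap.adjoint_inner_right, inner_self_eq_norm_sq] at h2
  change ‖x - ContinuousLinearMap.adjoint T (T x)‖ ^ 2 ≤ _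
  nlinarith [norm_nonneg (ContinuousLinearMap.adjoint T (T x)), norm_nonneg (T x)]

/-- The fixed vectors of the contraction `1 - T*T` are `ker T*T = ker T`, so by von Neumann's mean
ergodic theorem its averaged powers converge strongly to the projection onto `ker T`. This takes the
place of functional calculus. -/
theorem tendsto_trace_average {T : ψ.EllFun ι →L[ℂ] ψ.EllFun κ} (hT : ‖T‖ ≤ 1)
    {V : Submodule ℂ (ψ.EllFun ι)} [V.HasOrthogonalProjection] (hV : ∀ x, x ∈ V ↔ T x = 0) :
    Tendsto (fun n : ℕ => (n : ℝ)⁻¹ * ∑ k ∈ Finset.range n,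
        trace (((1 : ψ.EllFun ι →L[ℂ] ψ.EllFun ι) - ContinuousLinearMap.adjoint T ∘L T) ^ k))
      atTop (nhds (trace V.starProjection)) := by
  set U := (1 : ψ.EllFun ι →L[ℂ] ψ.EllFun ι) - ContinuousLinearMap.adjoint T ∘L T with hU
  have hloc : LinearMap.eqLocus (U : ψ.EllFun ι →ₗ[ℂ] ψ.EllFun ι)
      ((1 : ψ.EllFun ι →L[ℂ] ψ.EllFun ι) : ψ.EllFun ι →ₗ[ℂ] ψ.EllFun ι) = V := by
    ext x
    rw [hV, LinearMap.mem_eqLocus]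
    change x - ContinuousLinearMap.adjoint T (T x) = x ↔ _
    rw [sub_eq_self]
    refine ⟨fun h => ?_, fun h => by rw [h, map_zero]⟩
    rw [← inner_self_eq_zero (𝕜 := ℂ), ← ContinuousLinearMap.adjoint_inner_right, h,
      inner_zero_right]
  have key : ∀ x, Tendsto (birkhoffAverage ℂ U _root_.id · x) atTop
      (nhds (V.starProjection x)) := by
    intro x
    subst hloc
    exact U.tendsto_birkhoffAverage_orthogonalProjection (norm_one_sub_adjoint_comp_le hT) x
  have h2 : Tendsto (fun n : ℕ => ∑ i : ι, (inner ℂ (birkhoffAverage ℂ U _root_.id n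
      (ψ.incl i (ψ.delta 1))) (ψ.incl i (ψ.delta 1))).re) atTop
      (nhds (trace V.starProjection)) := by
    refine tendsto_finsetSum _ fun i _ => ?_
    exact (Complex.continuous_re.tendsto _).comp ((key _).inner tendsto_const_nhds)
  refine h2.congr fun n => ?_
  simp only [trace]
  rw [Finset.sum_comm, Finset.mul_sum]
  refine Finset.sum_congr rfl fun i _ => ?_
  rw [birkhoffAverage, birkhoffSum, inner_smul_left, sum_inner]
  have : conj ((n : ℂ)⁻¹) = (((n : ℝ)⁻¹ : ℝ) : ℂ) := by simp
  rw [this, Complex.re_ofReal_mul, Complex.re_sum]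
  congr 1
  refine Finset.sum_congr rfl fun k _ => ?_
  have hpow : ∀ x, (U ^ k) x = U^[k] x := fun x => by
    rw [pow_apply_eq_iterate]
  rw [hpow]
  rfl

/-- By geometric sums, `1 - (1 - T*T)ⁿ` and `1 - (1 - TT*)ⁿ` are products of the same two operators,
`T` and `(∑ Uᵏ) T*`, in opposite orders; traciality equates their traces. -/
theorem trace_pow_one_sub {T : ψ.EllFun ι →L[ℂ] ψ.EllFun κ} (hT : LeftEquivariant T) (n : ℕ) :
    trace (((1 : ψ.EllFun ι →L[ℂ] ψ.EllFun ι) - ContinuousLinearMap.adjoint T ∘L T) ^ n)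
        - Fintype.card ι =
      trace (((1 : ψ.EllFun κ →L[ℂ] ψ.EllFun κ) - T ∘L ContinuousLinearMap.adjoint T) ^ n)
        - Fintype.card κ := by
  set A := ContinuousLinearMap.adjoint T with hA
  have hA' : LeftEquivariant A := hT.adjoint
  set U := (1 : ψ.EllFun ι →L[ℂ] ψ.EllFun ι) - A ∘L T with hU
  set W := (1 : ψ.EllFun κ →L[ℂ] ψ.EllFun κ) - T ∘L A with hW
  have hUeq : LeftEquivariant U := leftEquivariant_one.sub (hA'.comp hT)
  have hpow : ∀ k, T ∘L (U ^ k) = (W ^ k) ∘L T := by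
    intro k
    induction k with
    | zero => rfl
    | succ k ih =>
      have h1 : T ∘L U = W ∘L T := by ext x; simp [hU, hW]
      calc T ∘L (U ^ (k + 1)) = (T ∘L (U ^ k)) ∘L U := by rw [pow_succ]; rfl
        _ = (W ^ k) ∘L (T ∘L U) := by rw [ih]; rfl
        _ = (W ^ (k + 1)) ∘L T := by rw [h1, pow_succ]; rfl
  have e1 : 1 - U ^ n = ((∑ k ∈ Finset.range n, U ^ k) ∘L A) ∘L T := by
    have h : 1 - U = A ∘L T := by rw [hU, sub_sub_cancel]
    rw [← geom_sum_mul_neg, h]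
    rfl
  have e2 : 1 - W ^ n = T ∘L ((∑ k ∈ Finset.range n, U ^ k) ∘L A) := by
    have h : 1 - W = T ∘L A := by rw [hW, sub_sub_cancel]
    rw [← geom_sum_mul_neg, h]
    have h' : T ∘L (∑ k ∈ Finset.range n, U ^ k) = (∑ k ∈ Finset.range n, W ^ k) ∘L T := by
      ext x : 1
      simp only [ContinuousLinearMap.comp_apply, _root_.sum_apply, map_sum]
      exact Finset.sum_congr rfl fun k _ => congrArg (fun S => S x) (hpow k)
    change ((∑ k ∈ Finset.range n, W ^ k) ∘L T) ∘L A = _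
    rw [← h']
    rfl
  have e3 := trace_comm hT ((LeftEquivariant.sum (fun k => hUeq.pow k) n).comp hA')
  rw [← e1, ← e2, trace_sub, trace_sub, trace_one, trace_one] at e3
  linarith

/-- The orthogonal complements of the kernels of an equivariant operator and of its adjoint have
the same dimension. -/
theorem trace_starProjection_ker {T : ψ.EllFun ι →L[ℂ] ψ.EllFun κ} (hT : LeftEquivariant T)
    {V : Submodule ℂ (ψ.EllFun ι)} {W : Submodule ℂ (ψ.EllFun κ)} [V.HasOrthogonalProjection]
    [W.HasOrthogonalProjection] (hV : ∀ x, x ∈ V ↔ T x = 0)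
    (hW : ∀ y, y ∈ W ↔ ContinuousLinearMap.adjoint T y = 0) :
    trace V.starProjection - Fintype.card ι = trace W.starProjection - Fintype.card κ := by
  -- Rescaling makes `T` a contraction without changing either kernel.
  set c : ℂ := (((‖T‖ + 1)⁻¹ : ℝ) : ℂ) with hc
  have hpos : 0 < ‖T‖ + 1 := by positivity
  have hc0 : c ≠ 0 := by
    rw [hc]; exact_mod_cast (inv_pos.2 hpos).ne'
  have hcT : ‖c • T‖ ≤ 1 := by
    refine (ContinuousLinearMap.opNorm_smul_le c T).trans ?_
    rw [hc, Complex.norm_real, Real.norm_of_nonneg (inv_pos.2 hpos).le, inv_mul_le_iff₀ hpos]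
    linarith
  have h1 := tendsto_trace_average (T := c • T) hcT (V := V) fun x => by
    rw [hV, _root_.smul_apply, smul_eq_zero_iff_right hc0]
  have h2 := tendsto_trace_average (T := ContinuousLinearMap.adjoint (c • T))
    (by rwa [LinearIsometryEquiv.norm_map]) (V := W) fun x => by
      rw [hW, map_smulₛₗ, _root_.smul_apply, smul_eq_zero_iff_right]
      simpa using hc0
  rw [ContinuousLinearMap.adjoint_adjoint] at h2
  refine tendsto_nhds_unique_of_eventuallyEq (h1.sub_const _) (h2.sub_const _) ?_
  -- For `n = 0` the average of a constant is `0` instead of the constant.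
  filter_upwards [eventually_ge_atTop 1] with n hn
  have hn' : (n : ℝ) ≠ 0 := by positivity
  have e : ∀ (f : ℕ → ℝ) (a : ℝ), (n : ℝ)⁻¹ * ∑ k ∈ Finset.range n, f k - a =
      (n : ℝ)⁻¹ * ∑ k ∈ Finset.range n, (f k - a) := by
    intro f a
    rw [Finset.sum_sub_distrib, Finset.sum_const, Finset.card_range, nsmul_eq_mul]
    field_simp
  rw [e, e]
  congr 1
  exact Finset.sum_congr rfl fun k _ => trace_pow_one_sub (hT.smul c) k

theorem trace_starProjection_orthogonal (V : Submodule ℂ (ψ.EllFun ι))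
    [V.HasOrthogonalProjection] :
    trace Vᗮ.starProjection = Fintype.card ι - trace V.starProjection := by
  rw [Submodule.starProjection_orthogonal', trace_sub, trace_one]

theorem trace_starProjection_mono {V W : Submodule ℂ (ψ.EllFun ι)} [V.HasOrthogonalProjection]
    [W.HasOrthogonalProjection] (h : V ≤ W) : trace V.starProjection ≤ trace W.starProjection :=
  Finset.sum_le_sum fun _ _ => Submodule.re_inner_starProjection_mono h _

/-- Subadditivity of the dimension along an equivariant operator. -/
theorem trace_starProjection_le_add {A : ψ.EllFun ι →L[ℂ] ψ.EllFun κ} (hA : LeftEquivariant A)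
    {V N : Submodule ℂ (ψ.EllFun ι)} {W : Submodule ℂ (ψ.EllFun κ)} [V.HasOrthogonalProjection]
    [N.HasOrthogonalProjection] [W.HasOrthogonalProjection] (hV : LeftInvariant V)
    (hAV : ∀ x ∈ V, A x ∈ W) (hN : ∀ x ∈ V, A x = 0 → x ∈ N) :
    trace V.starProjection ≤ trace N.starProjection + trace W.starProjection := by
  -- Cutting `A` down to `V` gives `ker T = Vᗮ ⊕ (V ∩ ker T)` and puts the range in `W`, so `Wᗮ ≤
  -- ker T*`. The rank theorem for `T` then gives the inequality.
  set T := A ∘L V.starProjection with hT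
  have hTeq : LeftEquivariant T := hA.comp hV.starProjection
  set K := LinearMap.ker (T : ψ.EllFun ι →ₗ[ℂ] ψ.EllFun κ) with hK
  set K' := LinearMap.ker (ContinuousLinearMap.adjoint T : ψ.EllFun κ →ₗ[ℂ] ψ.EllFun ι) with hK'
  set M := V ⊓ K with hM
  have : K.HasOrthogonalProjection := IsClosed.hasOrthogonalProjection T.isClosed_ker
  have : K'.HasOrthogonalProjection :=
    IsClosed.hasOrthogonalProjection (ContinuousLinearMap.adjoint T).isClosed_ker
  have : M.HasOrthogonalProjection := by
    have hVc : IsClosed (V : Set (ψ.EllFun ι)) := by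
      rw [← V.orthogonal_orthogonal]; exact Submodule.isClosed_orthogonal _
    exact IsClosed.hasOrthogonalProjection (hVc.inter T.isClosed_ker)
  have h1 := trace_starProjection_ker hTeq (V := K) (W := K') (fun _ => Iff.rfl) (fun _ => Iff.rfl)
  have h2 : trace K.starProjection = trace Vᗮ.starProjection + trace M.starProjection := by
    rw [← trace_add]
    congr 1
    ext1 u
    refine Submodule.starProjection_eq_add ?_ inf_le_right ?_ ?_ u
    · intro x hx
      change A (V.starProjection x) = 0
      rw [(Submodule.starProjection_apply_eq_zero_iff V).2 hx, map_zero]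
    · exact fun x hx y hy => (Submodule.mem_orthogonal' _ _).1 hx y hy.1
    · intro v hv
      refine ⟨v - V.starProjection v, V.sub_starProjection_mem_orthogonal v,
        V.starProjection v, ⟨V.starProjection_apply_mem v, ?_⟩, by abel⟩
      change A (V.starProjection (V.starProjection v)) = 0
      rw [Submodule.starProjection_eq_self_iff.2 (V.starProjection_apply_mem v)]
      exact hv
  have h3 : trace Wᗮ.starProjection ≤ trace K'.starProjection := by
    refine trace_starProjection_mono fun y hy => ?_
    change ContinuousLinearMap.adjoint T y = 0
    refine ext_inner_right ℂ fun x => ?_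
    rw [ContinuousLinearMap.adjoint_inner_left, inner_zero_left]
    exact (Submodule.mem_orthogonal' _ _).1 hy _ (hAV _ (V.starProjection_apply_mem x))
  have h4 : trace M.starProjection ≤ trace N.starProjection := by
    refine trace_starProjection_mono fun x hx => hN x hx.1 ?_
    have : A (V.starProjection x) = 0 := hx.2
    rwa [Submodule.starProjection_eq_self_iff.2 hx.1] at this
  rw [trace_starProjection_orthogonal] at h2 h3
  linarith

end GroupCharacter

theorem Submodule.mem_orthogonal_span {E : Type*} [NormedAddCommGroup E] [InnerProductSpace ℂ E]
    {s : Set E} {y : E} : y ∈ (Submodule.span ℂ s)ᗮ ↔ ∀ x ∈ s, inner ℂ x y = 0 := by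
  refine ⟨fun h x hx => h x (Submodule.subset_span hx), fun h x hx => ?_⟩
  induction hx using Submodule.span_induction with
  | mem x hx => exact h x hx
  | zero => exact inner_zero_left _
  | add a b _ _ ha hb => rw [inner_add_left, ha, hb, add_zero]
  | smul c a _ ha => rw [inner_smul_left, ha, mul_zero]

namespace GroupCharacter

variable {G Γ : Type*} [Group G] [Group Γ] {ι κ : Type*} [Fintype ι] [Fintype κ]

/-! ### The adjoint of the right action of the group ring -/

section CoRing

variable (ψ : GroupCharacter G)

/-- Right translation by inverses, as a homomorphism. -/
def rightInv : G →* (ψ.Ell →L[ℂ] ψ.Ell) where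
  toFun g := ψ.right g⁻¹
  map_one' := by rw [inv_one, right_one]
  map_mul' g h := by rw [mul_inv_rev, right_mul]

/-- Conjugate scalar multiplication, as a homomorphism. -/
def conjScalar : ℂ →+* (ψ.Ell →L[ℂ] ψ.Ell) where
  toFun c := conj c • 1
  map_one' := by rw [_root_.map_one, one_smul]
  map_mul' c d := by
    ext x
    change conj (c * d) • x = conj c • conj d • x
    rw [map_mul, mul_smul]
  map_zero' := by rw [map_zero, zero_smul]
  map_add' c d := by rw [map_add, add_smul]

theorem commute_conjScalar_rightInv (c : ℂ) (g : G) :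
    Commute (ψ.conjScalar c) (ψ.rightInv g) := by
  ext x
  exact (map_smul (ψ.rightInv g) (conj c) x).symm

/-- The action of `z ∈ ℂ[G]` on `ℓ^ψ(G)` by the adjoint of `ψ.rightRing z`. -/
def coRing : MonoidAlgebra ℂ G →+* (ψ.Ell →L[ℂ] ψ.Ell) :=
  MonoidAlgebra.liftNCRingHom ψ.conjScalar ψ.rightInv ψ.commute_conjScalar_rightInv

theorem coRing_single (g : G) (c : ℂ) (ξ : ψ.Ell) :
    ψ.coRing (MonoidAlgebra.single g c) ξ = conj c • ψ.right g⁻¹ ξ := by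
  unfold coRing
  rw [MonoidAlgebra.liftNCRingHom_single]
  rfl

theorem rightRing_single (g : G) (c : ℂ) :
    ψ.rightRing (MonoidAlgebra.single g c) = c • ψ.right g :=
  Finsupp.sum_single_index (zero_smul _ _)

theorem rightRing_add (z w : MonoidAlgebra ℂ G) :
    ψ.rightRing (z + w) = ψ.rightRing z + ψ.rightRing w :=
  Finsupp.sum_add_index' (fun _ => zero_smul _ _) (fun _ _ _ => add_smul _ _ _)

theorem rightRing_zero : ψ.rightRing 0 = 0 := Finsupp.sum_zero_index

/-- Right translation reverses products and so does taking adjoints, which is why `coRing` is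
multiplicative, with scalars conjugated. Moving `z` across the inner product turns orthogonality to
boundaries into cocycle equations. -/
theorem inner_rightRing (z : MonoidAlgebra ℂ G) (ξ η : ψ.Ell) :
    inner ℂ (ψ.rightRing z ξ) η = inner ℂ ξ (ψ.coRing z η) := by
  induction z using MonoidAlgebra.induction_linear with
  | zero => simp [rightRing_zero]
  | add z w hz hw =>
    rw [rightRing_add, map_add, _root_.add_apply, _root_.add_apply, inner_add_left,
      inner_add_right, hz, hw]
  | single g c =>
    rw [rightRing_single, coRing_single, _root_.smul_apply, inner_smul_left, inner_smul_right,
      inner_right_left]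

theorem coRing_left (z : MonoidAlgebra ℂ G) (g : G) (ξ : ψ.Ell) :
    ψ.coRing z (ψ.left g ξ) = ψ.left g (ψ.coRing z ξ) := by
  induction z using MonoidAlgebra.induction_linear with
  | zero => simp
  | add z w hz hw =>
    rw [map_add, _root_.add_apply, _root_.add_apply, hz, hw, map_add]
  | single h c => rw [coRing_single, coRing_single, map_smul, left_right]

end CoRing

/-! ### Homomorphisms compatible with the characters -/

section Embed

variable {χ : GroupCharacter Γ} {ψ : GroupCharacter G} (f : Γ →* G) (hf : ∀ x, ψ (f x) = χ x)

/-- The isometry `ℓ^χ(Γ) → ℓ^ψ(G)` induced by a homomorphism with `χ = ψ ∘ f`. -/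
def embed : χ.Ell →L[ℂ] ψ.Ell :=
  mapEll χ ψ f (fun x y => by rw [← hf, map_mul, _root_.map_inv f])

theorem embed_delta (x : Γ) : embed f hf (χ.delta x) = ψ.delta (f x) := mapEll_delta _ _ _ _ _

theorem inner_embed (x y : χ.Ell) : inner ℂ (embed f hf x) (embed f hf y) = inner ℂ x y :=
  inner_mapEll _ _ _ _ _ _

theorem embed_right (x : Γ) (ξ : χ.Ell) :
    embed f hf (χ.right x ξ) = ψ.right (f x) (embed f hf ξ) := by
  have : embed f hf ∘L χ.right x = ψ.right (f x) ∘L embed f hf :=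
    χ.clm_ext fun k => by simp [right_delta, embed_delta]
  exact congrArg (fun T => T ξ) this

theorem embed_coRing (z : MonoidAlgebra ℂ Γ) (ξ : χ.Ell) :
    embed f hf (χ.coRing z ξ) = ψ.coRing (MonoidAlgebra.mapDomainRingHom ℂ f z)
      (embed f hf ξ) := by
  induction z using MonoidAlgebra.induction_linear with
  | zero => simp
  | add z w hz hw => simp only [map_add, _root_.add_apply, hz, hw]
  | single h c =>
    rw [coRing_single, map_smul, embed_right, _root_.map_inv f, MonoidAlgebra.mapDomainRingHom_apply,
      MonoidAlgebra.mapDomain_single, coRing_single]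

theorem embed_rightRing (z : MonoidAlgebra ℂ Γ) (ξ : χ.Ell) :
    embed f hf (χ.rightRing z ξ) = ψ.rightRing (MonoidAlgebra.mapDomainRingHom ℂ f z)
      (embed f hf ξ) := by
  induction z using MonoidAlgebra.induction_linear with
  | zero => simp [rightRing_zero]
  | add z w hz hw => simp only [map_add, rightRing_add, _root_.add_apply, hz, hw]
  | single h c =>
    rw [rightRing_single, _root_.smul_apply, map_smul, embed_right,
      MonoidAlgebra.mapDomainRingHom_apply, MonoidAlgebra.mapDomain_single, rightRing_single,
      _root_.smul_apply]

end Embed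

/-! ### Vectors fixed by right translations -/

section Fixed

variable (ψ : GroupCharacter G)

/-- The vectors of `ℓ^ψ(G)` fixed by right translation by the elements of `A`. -/
def fixed (A : Set G) : Submodule ℂ ψ.Ell where
  carrier := {ξ | ∀ g ∈ A, ψ.right g ξ = ξ}
  add_mem' hx hy g hg := by rw [map_add, hx g hg, hy g hg]
  zero_mem' g _ := map_zero _
  smul_mem' c x hx g hg := by rw [map_smul, hx g hg]

theorem mem_fixed {A : Set G} {ξ : ψ.Ell} : ξ ∈ ψ.fixed A ↔ ∀ g ∈ A, ψ.right g ξ = ξ := Iff.rfl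

theorem isClosed_fixed (A : Set G) : IsClosed (ψ.fixed A : Set ψ.Ell) := by
  have : (ψ.fixed A : Set ψ.Ell) = ⋂ g ∈ A, {ξ | ψ.right g ξ = ξ} := by
    ext; simp [mem_fixed]
  rw [this]
  exact isClosed_biInter fun g _ => isClosed_eq (by fun_prop) (by fun_prop)

instance (A : Set G) : (ψ.fixed A).HasOrthogonalProjection :=
  IsClosed.hasOrthogonalProjection (ψ.isClosed_fixed A)

theorem fixed_eq_orthogonal (A : Set G) :
    ψ.fixed A = (Submodule.span ℂ {x | ∃ g ∈ A, ∃ ξ : ψ.Ell, x = ψ.right g⁻¹ ξ - ξ})ᗮ := by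
  ext y
  rw [Submodule.mem_orthogonal_span]
  constructor
  · rintro h x ⟨g, hg, ξ, rfl⟩
    rw [inner_sub_left, inner_right_left, inv_inv, h g hg, sub_self]
  · intro h g hg
    refine ext_inner_left ℂ fun ξ => ?_
    have := h _ ⟨g, hg, ξ, rfl⟩
    rwa [inner_sub_left, inner_right_left, inv_inv, sub_eq_zero] at this

theorem fixed_closure (A : Set G) : ψ.fixed (Subgroup.closure A) = ψ.fixed A := by
  refine le_antisymm (fun x hx g hg => hx g (Subgroup.subset_closure hg)) fun x hx g hg => ?_
  induction hg using Subgroup.closure_induction with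
  | mem g hg => exact hx g hg
  | one => rw [right_one]; rfl
  | mul g h _ _ hg hh => rw [right_mul]; exact (congrArg _ hg).trans hh
  | inv g _ hg =>
    conv_lhs => rw [← hg]
    change (ψ.right g⁻¹ * ψ.right g) x = x
    rw [← right_mul, mul_inv_cancel, right_one]
    rfl

/-- The vectors of `ℓ^ψ(G)` fixed by right translations, as a subspace of `ℓ^ψ(G)^ι` for a
one-element set. -/
def fixedUnit (A : Set G) : Submodule ℂ (ψ.EllFun Unit) :=
  (ψ.fixed A).comap (PiLp.proj 2 (fun _ : Unit => ψ.Ell) ()).toLinearMap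

theorem mem_fixedUnit {A : Set G} {ξ : ψ.EllFun Unit} :
    ξ ∈ ψ.fixedUnit A ↔ ξ () ∈ ψ.fixed A := Iff.rfl

theorem isClosed_fixedUnit (A : Set G) : IsClosed (ψ.fixedUnit A : Set (ψ.EllFun Unit)) :=
  (ψ.isClosed_fixed A).preimage (PiLp.proj 2 (fun _ : Unit => ψ.Ell) ()).continuous

instance (A : Set G) : (ψ.fixedUnit A).HasOrthogonalProjection :=
  IsClosed.hasOrthogonalProjection (ψ.isClosed_fixedUnit A)

theorem incl_unit_apply (ξ : ψ.Ell) : ψ.incl () ξ () = ξ := by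
  simp [incl_apply]

theorem trace_fixedUnit (A : Set G) : trace (ψ.fixedUnit A).starProjection =
    (inner ℂ ((ψ.fixed A).starProjection (ψ.delta 1)) (ψ.delta 1)).re := by
  unfold trace
  rw [Fintype.sum_unique]
  change (inner ℂ ((ψ.fixedUnit A).starProjection (ψ.incl () (ψ.delta 1)))
    (ψ.incl () (ψ.delta 1))).re = _
  have h := Submodule.starProjection_map_of_inner (ψ.incl ()).toLinearMap (V := ψ.fixed A)
    (W := ψ.fixedUnit A) (fun x hx => by
      rw [mem_fixedUnit]
      exact (ψ.incl_unit_apply x).symm ▸ hx)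
    (fun x hx => by
      rw [Submodule.mem_orthogonal] at hx ⊢
      intro u hu
      rw [← inner_conj_symm]
      change conj (inner ℂ (ψ.incl () x) u) = 0
      rw [inner_incl, inner_conj_symm]
      exact hx _ hu) (ψ.delta 1)
  change (ψ.fixedUnit A).starProjection (ψ.incl () (ψ.delta 1)) =
    ψ.incl () ((ψ.fixed A).starProjection (ψ.delta 1)) at h
  rw [h, inner_incl, incl_unit_apply]

theorem bettiZero_eq : ψ.bettiZero =
    (inner ℂ ((ψ.fixed Set.univ).starProjection (ψ.delta 1)) (ψ.delta 1)).re := by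
  have h : (Submodule.span ℂ {x | ∃ (g : G) (ξ : ψ.Ell), x = ψ.right g ξ - ξ})ᗮ =
      ψ.fixed Set.univ := by
    rw [fixed_eq_orthogonal]
    congr 2
    ext x
    refine ⟨fun ⟨g, ξ, h⟩ => ⟨g⁻¹, trivial, ξ, by rwa [inv_inv]⟩,
      fun ⟨g, _, ξ, h⟩ => ⟨g⁻¹, ξ, h⟩⟩
  unfold bettiZero dimOne
  rw [h, traceDim_eq, Fintype.sum_unique]

theorem bettiZero_nonneg : 0 ≤ ψ.bettiZero := by
  rw [bettiZero_eq]
  exact Submodule.re_inner_starProjection_nonneg (ψ.fixed Set.univ) _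

/-- Right translation by the elements of a finite family of elements which are orthogonal in
`ℓ^ψ(G)` has few fixed vectors. -/
theorem re_inner_fixed_le (F : Finset G) (hF : F.Nonempty)
    (hψ : ∀ k ∈ F, ∀ l ∈ F, k ≠ l → ψ (k⁻¹ * l) = 0) {A : Set G} (hFA : (F : Set G) ⊆ A) :
    (inner ℂ ((ψ.fixed A).starProjection (ψ.delta 1)) (ψ.delta 1)).re ≤ 1 / (F.card : ℝ) := by
  set v := (ψ.fixed A).starProjection (ψ.delta 1) with hv
  set d := (inner ℂ v (ψ.delta 1)).re with hd
  have hvd : ‖v‖ ^ 2 = d := (Submodule.re_inner_starProjection_eq_normSq (ψ.fixed A) _).symm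
  have hvA : v ∈ ψ.fixed A := Submodule.starProjection_apply_mem _ _
  -- A fixed vector has equal coefficients along all `δ_k`, `k ∈ F`. Bessel's inequality then gives
  -- `|F| d² ≤ ‖v‖² = d`.
  have hconst : ∀ k ∈ F, inner ℂ (ψ.delta k) v = inner ℂ (ψ.delta 1) v := by
    intro k hk
    have h : ψ.delta k = ψ.right k (ψ.delta 1) := by rw [right_delta, one_mul]
    rw [h]
    conv_lhs => rw [← hvA k (hFA hk)]
    rw [inner_right_right]
  have hon : Orthonormal ℂ (fun k : F => ψ.delta k) := by
    refine ⟨fun k => ψ.norm_delta k, fun k l hkl => ?_⟩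
    change inner ℂ (ψ.delta k) (ψ.delta l) = 0
    rw [inner_delta]
    exact hψ k k.2 l l.2 fun h => hkl (Subtype.ext h)
  have hB := hon.sum_inner_products_le v (s := Finset.univ)
  have hdle : d ≤ ‖inner ℂ (ψ.delta 1) v‖ := by
    rw [norm_inner_symm]; exact Complex.re_le_norm _
  have hd0 : 0 ≤ d := hvd ▸ sq_nonneg _
  have hsum : (F.card : ℝ) * d ^ 2 ≤ d := by
    rw [hvd] at hB
    refine le_trans ?_ hB
    rw [Finset.sum_congr rfl fun (k : F) _ => by rw [hconst k k.2], Finset.sum_const,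
      Finset.card_univ, Fintype.card_coe, nsmul_eq_mul]
    gcongr
  have hc : (0 : ℝ) < F.card := by exact_mod_cast hF.card_pos
  rw [le_div_iff₀ hc]
  rcases hd0.eq_or_lt with h | h
  · rw [← h]; simp
  · nlinarith

end Fixed

/-! ### The space of cocycles -/

section Cocycles

variable (ψ : GroupCharacter G) (f : Γ →* G) (s : ι → Γ)

/-- The `1`-cocycles of the group generated by `s` with values in `ℓ^ψ(G)`, given by their values
on the generators: the families `η` annihilated by all relations between the elements
`s i - 1 ∈ ℂ[Γ]`. -/
def cocycles : Submodule ℂ (ψ.EllFun ι) where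
  carrier := {η | ∀ z : ι → MonoidAlgebra ℂ Γ, ∑ i, z i * (MonoidAlgebra.single (s i) 1 - 1) = 0 →
    ∑ i, ψ.coRing (MonoidAlgebra.mapDomainRingHom ℂ f (z i)) (η i) = 0}
  add_mem' hx hy z hz := by
    simp only [PiLp.add_apply, map_add, Finset.sum_add_distrib]
    rw [hx z hz, hy z hz, add_zero]
  zero_mem' z _ := by simp
  smul_mem' c x hx z hz := by
    simp only [PiLp.smul_apply, map_smul]
    rw [← Finset.smul_sum, hx z hz, smul_zero]

theorem mem_cocycles {η : ψ.EllFun ι} : η ∈ ψ.cocycles f s ↔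
    ∀ z : ι → MonoidAlgebra ℂ Γ, ∑ i, z i * (MonoidAlgebra.single (s i) 1 - 1) = 0 →
      ∑ i, ψ.coRing (MonoidAlgebra.mapDomainRingHom ℂ f (z i)) (η i) = 0 := Iff.rfl

theorem isClosed_cocycles : IsClosed (ψ.cocycles f s : Set (ψ.EllFun ι)) := by
  have : (ψ.cocycles f s : Set (ψ.EllFun ι)) = ⋂ z : ι → MonoidAlgebra ℂ Γ,
      ⋂ _ : ∑ i, z i * (MonoidAlgebra.single (s i) 1 - 1) = 0,
        {η | ∑ i, ψ.coRing (MonoidAlgebra.mapDomainRingHom ℂ f (z i)) (η i) = 0} := by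
    ext; simp [mem_cocycles]
  rw [this]
  exact isClosed_iInter fun z => isClosed_iInter fun _ => isClosed_eq (by fun_prop) (by fun_prop)

instance : (ψ.cocycles f s).HasOrthogonalProjection :=
  IsClosed.hasOrthogonalProjection (ψ.isClosed_cocycles f s)

theorem leftInvariant_cocycles : LeftInvariant (ψ.cocycles f s) := by
  intro g x hx z hz
  simp only [coordwise_apply, coRing_left]
  rw [← map_sum, hx z hz, map_zero]

end Cocycles

/-! ### The first Betti number through cocycles -/

section BettiOne

variable (ψ : GroupCharacter G) (S : Finset G)

theorem cocycles_eq_orthogonal :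
    ψ.cocycles (MonoidHom.id G) (Subtype.val : S → G) = (ψ.boundaries S)ᗮ := by
  have key : ∀ (ξ : ψ.Ell) (z : S → MonoidAlgebra ℂ G) (η : ψ.EllPow S),
      inner ℂ (WithLp.toLp 2 fun s => ψ.rightRing (z s) ξ : ψ.EllPow S) η =
        inner ℂ ξ (∑ i, ψ.coRing (z i) (η i)) := by
    intro ξ z η
    rw [PiLp.inner_apply, inner_sum]
    exact Finset.sum_congr rfl fun i _ => ψ.inner_rightRing _ _ _
  ext η
  unfold boundaries
  rw [Submodule.mem_orthogonal_span, mem_cocycles]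
  simp only [MonoidAlgebra.mapDomainRingHom_id, RingHom.id_apply]
  constructor
  · rintro h x ⟨ξ, z, hz, rfl⟩
    rw [key, h z hz, inner_zero_right]
  · intro h z hz
    refine ext_inner_left ℂ fun ξ => ?_
    rw [← key, inner_zero_right]
    exact h _ ⟨ξ, z, hz, rfl⟩

/-- The operator whose adjoint is `ψ.boundary S`. -/
def coboundary : ψ.EllFun Unit →L[ℂ] ψ.EllPow S :=
  ψ.ofMatrix fun s _ => ψ.right (s : G)⁻¹ - 1

theorem leftEquivariant_coboundary : LeftEquivariant (ψ.coboundary S) := by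
  refine leftEquivariant_ofMatrix fun s _ g x => ?_
  change ψ.right _ (ψ.left g x) - ψ.left g x = ψ.left g (ψ.right _ x - x)
  rw [map_sub, left_right]

theorem inner_boundary (ξ : ψ.EllPow S) (η : ψ.EllFun Unit) :
    inner ℂ (ψ.boundary S ξ) (η ()) = inner ℂ ξ (ψ.coboundary S η) := by
  change inner ℂ (∑ s : S, (ψ.right (s : G) (ξ s) - ξ s)) (η ()) = _
  rw [sum_inner, PiLp.inner_apply]
  refine Finset.sum_congr rfl fun s _ => ?_
  rw [coboundary, ofMatrix_apply, Fintype.sum_unique]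
  change _ = inner ℂ (ξ s) (ψ.right (s : G)⁻¹ (η ()) - η ())
  rw [inner_sub_left, inner_sub_right, inner_right_left]

theorem mem_ker_boundary (ξ : ψ.EllPow S) : ξ ∈ LinearMap.ker (ψ.boundary S) ↔
    ContinuousLinearMap.adjoint (ψ.coboundary S) ξ = 0 := by
  rw [LinearMap.mem_ker]
  constructor
  · intro h
    refine ext_inner_right ℂ fun η => ?_
    rw [ContinuousLinearMap.adjoint_inner_left, ← inner_boundary, h, inner_zero_left,
      inner_zero_left]
  · intro h
    refine ext_inner_right ℂ fun y => ?_
    have := ψ.inner_boundary S ξ (ψ.incl () y)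
    rw [incl_unit_apply] at this
    rw [this, ← ContinuousLinearMap.adjoint_inner_left, h, inner_zero_left, inner_zero_left]

theorem isClosed_ker_boundary : IsClosed (LinearMap.ker (ψ.boundary S) : Set (ψ.EllPow S)) := by
  have : (LinearMap.ker (ψ.boundary S) : Set (ψ.EllPow S)) =
      {ξ | ContinuousLinearMap.adjoint (ψ.coboundary S) ξ = 0} := by
    ext ξ; exact ψ.mem_ker_boundary S ξ
  rw [this]
  exact isClosed_eq (by fun_prop) (by fun_prop)

instance : (LinearMap.ker (ψ.boundary S)).HasOrthogonalProjection :=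
  IsClosed.hasOrthogonalProjection (ψ.isClosed_ker_boundary S)

theorem coboundary_eq_zero_iff (η : ψ.EllFun Unit) :
    η ∈ ψ.fixedUnit ((S : Set G)⁻¹) ↔ ψ.coboundary S η = 0 := by
  have h : ∀ s : S, ψ.coboundary S η s = ψ.right (s : G)⁻¹ (η ()) - η () := by
    intro s
    rw [coboundary, ofMatrix_apply, Fintype.sum_unique]
    rfl
  constructor
  · intro hη
    ext s
    rw [h]
    exact sub_eq_zero.2 (hη _ (Set.inv_mem_inv.2 s.2))
  · intro hη g hg
    have := h ⟨g⁻¹, hg⟩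
    rw [hη, inv_inv] at this
    exact (sub_eq_zero.1 this.symm)

/-- Dual form of `∂₁∂₂ = 0`: the coboundary of `η` has entries `(s - 1)·η`, so every relation among
the `s - 1` annihilates it. -/
theorem coboundary_mem_cocycles (η : ψ.EllFun Unit) :
    ψ.coboundary S η ∈ ψ.cocycles (MonoidHom.id G) (Subtype.val : S → G) := by
  rw [mem_cocycles]
  intro z hz
  simp only [MonoidAlgebra.mapDomainRingHom_id, RingHom.id_apply]
  have h : ∀ s : S, ψ.coboundary S η s =
      ψ.coRing (MonoidAlgebra.single (s : G) 1 - 1) (η ()) := by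
    intro s
    rw [coboundary, ofMatrix_apply, Fintype.sum_unique, map_sub, _root_.sub_apply,
      _root_.sub_apply, coRing_single, _root_.map_one, _root_.map_one, one_smul]
  have h2 : ∀ s : S, ψ.coRing (z s) (ψ.coboundary S η s) =
      ψ.coRing (z s * (MonoidAlgebra.single (s : G) 1 - 1)) (η ()) := by
    intro s
    rw [h, map_mul]
    rfl
  rw [Finset.sum_congr rfl fun s _ => h2 s, ← _root_.sum_apply, ← map_sum, hz, map_zero]
  rfl

theorem isClosed_ker_inf_orthogonal :
    IsClosed ((LinearMap.ker (ψ.boundary S) ⊓ (ψ.boundaries S)ᗮ : Submodule ℂ (ψ.EllPow S)) :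
      Set (ψ.EllPow S)) :=
  (ψ.isClosed_ker_boundary S).inter (Submodule.isClosed_orthogonal _)

instance : (LinearMap.ker (ψ.boundary S) ⊓ (ψ.boundaries S)ᗮ).HasOrthogonalProjection :=
  IsClosed.hasOrthogonalProjection (ψ.isClosed_ker_inf_orthogonal S)

theorem dimPow_eq (V : Submodule ℂ (ψ.EllPow S)) [V.HasOrthogonalProjection] :
    ψ.dimPow S V = trace V.starProjection := by
  classical
  unfold dimPow trace
  rw [traceDim_eq]
  simp only [incl_apply]

/-- The first Betti number in terms of the dimension of the space of cocycles. -/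
theorem bettiOneOf_eq (hS : Subgroup.closure (S : Set G) = ⊤) : ψ.bettiOneOf S =
    trace (ψ.cocycles (MonoidHom.id G) (Subtype.val : S → G)).starProjection
      + ψ.bettiZero - 1 := by
  -- The kernel of the coboundary is the space of invariant vectors, of dimension `b₀`, and the
  -- kernel of its adjoint is `ker ∂₁`. Thus `b₀ - 1 = dim ker ∂₁ - |S|`.
  have h1 := trace_starProjection_ker (ψ.leftEquivariant_coboundary S)
    (ψ.coboundary_eq_zero_iff S) (ψ.mem_ker_boundary S)
  have h2 : ψ.fixed ((S : Set G)⁻¹) = ψ.fixed Set.univ := by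
    rw [← fixed_closure, Subgroup.closure_inv, hS]
    rfl
  rw [trace_fixedUnit] at h1
  simp only [h2] at h1
  rw [← bettiZero_eq] at h1
  unfold bettiOneOf
  rw [dimPow_eq]
  -- Hodge-type splitting `Z = (Z ∩ ker ∂₁) ⊕ (ker ∂₁)ᗮ`: harmonic cocycles, of dimension `b₁`, and
  -- the closure of the coboundaries.
  have h3 : trace (ψ.cocycles (MonoidHom.id G) (Subtype.val : S → G)).starProjection =
      trace (LinearMap.ker (ψ.boundary S) ⊓ (ψ.boundaries S)ᗮ).starProjection +
        trace (LinearMap.ker (ψ.boundary S))ᗮ.starProjection := by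
    have hle : (LinearMap.ker (ψ.boundary S))ᗮ ≤
        ψ.cocycles (MonoidHom.id G) (Subtype.val : S → G) := by
      rw [cocycles_eq_orthogonal]
      refine Submodule.orthogonal_le (Submodule.span_le.2 ?_)
      intro x hx
      rw [SetLike.mem_coe, mem_ker_boundary]
      refine ext_inner_right ℂ fun η => ?_
      rw [ContinuousLinearMap.adjoint_inner_left, inner_zero_left]
      have := ψ.coboundary_mem_cocycles S η
      rw [cocycles_eq_orthogonal] at this
      exact this x (Submodule.subset_span hx)
    rw [← trace_add]
    congr 1
    ext1 u
    refine Submodule.starProjection_eq_add ?_ hle ?_ ?_ u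
    · rw [cocycles_eq_orthogonal]
      exact inf_le_right
    · exact fun x hx y hy => hy x hx.1
    · intro v hv
      have hm : v - (LinearMap.ker (ψ.boundary S)).starProjection v ∈
        (LinearMap.ker (ψ.boundary S))ᗮ := Submodule.sub_starProjection_mem_orthogonal v
      refine ⟨(LinearMap.ker (ψ.boundary S)).starProjection v,
        ⟨Submodule.starProjection_apply_mem _ v, ?_⟩, _, hm, by abel⟩
      rw [← cocycles_eq_orthogonal]
      have := Submodule.sub_mem _ hv (hle hm)
      rwa [sub_sub_cancel] at this
  rw [trace_starProjection_orthogonal] at h3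
  rw [h3]
  simp only [Fintype.card_unit, Nat.cast_one] at h1
  linarith

/-- The dimension of the space of cocycles does not change under extension of the group in which
coefficients are taken. -/
theorem trace_cocycles_map {χ : GroupCharacter Γ} (ψ : GroupCharacter G) (f : Γ →* G)
    (hf : ∀ x, ψ (f x) = χ x) (S : Finset Γ) :
    trace (ψ.cocycles f (Subtype.val : S → Γ)).starProjection =
      trace (χ.cocycles (MonoidHom.id Γ) (Subtype.val : S → Γ)).starProjection := by
  set i := coordwise S (embed f hf) with hi
  have hincl : ∀ s : S, ψ.incl s (ψ.delta 1) = i (χ.incl s (χ.delta 1)) := by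
    classical
    intro s
    ext t
    by_cases h : t = s
    · subst h; simp [hi, incl_apply, embed_delta]
    · simp [hi, incl_apply, h]
  have hinner : ∀ x y, inner ℂ (i x) (i y) = inner ℂ x y := by
    intro x y
    simp only [PiLp.inner_apply, hi, coordwise_apply, inner_embed]
  have h := Submodule.starProjection_map_of_inner i.toLinearMap
    (V := χ.cocycles (MonoidHom.id Γ) (Subtype.val : S → Γ))
    (W := ψ.cocycles f (Subtype.val : S → Γ)) (fun x hx => by
      rw [mem_cocycles] at hx ⊢
      intro z hz
      change ∑ s, ψ.coRing _ (embed f hf (x s)) = 0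
      simp only [← embed_coRing]
      have := hx z hz
      simp only [MonoidAlgebra.mapDomainRingHom_id, RingHom.id_apply] at this
      rw [← map_sum, this, map_zero])
    -- The complement of the cocycles is the closure of the boundaries. The embedding sends `ξ · z`
    -- to `(embed ξ) · f(z)`, which is orthogonal to every cocycle with coefficients in `ℓ^ψ(G)`.
    (fun x hx => by
      rw [cocycles_eq_orthogonal, Submodule.orthogonal_orthogonal_eq_closure] at hx
      have hle : (χ.boundaries S).topologicalClosure ≤
          ((ψ.cocycles f (Subtype.val : S → Γ))ᗮ).comap i.toLinearMap := by
        refine Submodule.topologicalClosure_minimal _ (Submodule.span_le.2 ?_)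
          ((Submodule.isClosed_orthogonal _).preimage i.continuous)
        rintro x ⟨ξ, z, hz, rfl⟩
        rw [SetLike.mem_coe, Submodule.mem_comap, Submodule.mem_orthogonal']
        intro η hη
        rw [PiLp.inner_apply]
        change ∑ s, inner ℂ (embed f hf (χ.rightRing (z s) ξ)) (η s) = 0
        simp only [embed_rightRing, inner_rightRing]
        rw [← inner_sum, hη z hz, inner_zero_right]
      exact hle hx)
  unfold trace
  refine Finset.sum_congr rfl fun s _ => ?_
  rw [hincl]
  have hs := h (χ.incl s (χ.delta 1))
  change (ψ.cocycles f (Subtype.val : S → Γ)).starProjection (i (χ.incl s (χ.delta 1))) =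
    i ((χ.cocycles (MonoidHom.id Γ) (Subtype.val : S → Γ)).starProjection
      (χ.incl s (χ.delta 1))) at hs
  rw [hs, hinner]

end BettiOne

/-! ### Adding one generator -/

/-- The augmentation ideal is generated on the left by the `t i - 1`, via Fox calculus: `gh - 1 = (g
- 1) + g(h - 1)` and `g⁻¹ - 1 = -g⁻¹(g - 1)`. -/
theorem exists_sum_mul_single_sub_one {t : ι → G} (ht : Subgroup.closure (Set.range t) = ⊤)
    (g : G) : ∃ z : ι → MonoidAlgebra ℂ G,
      ∑ i, z i * (MonoidAlgebra.single (t i) 1 - 1) = MonoidAlgebra.single g 1 - 1 := by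
  have hg : g ∈ Subgroup.closure (Set.range t) := ht ▸ Subgroup.mem_top g
  induction hg using Subgroup.closure_induction with
  | mem g hg =>
    classical
    obtain ⟨i, rfl⟩ := hg
    refine ⟨Pi.single i 1, ?_⟩
    rw [Finset.sum_eq_single i]
    · simp
    · intro j _ hj; simp [hj]
    · simp
  | one => exact ⟨0, by simp [MonoidAlgebra.one_def]⟩
  | mul g h _ _ hg hh =>
    obtain ⟨z, hz⟩ := hg
    obtain ⟨w, hw⟩ := hh
    refine ⟨fun i => z i + MonoidAlgebra.single g 1 * w i, ?_⟩
    simp only [add_mul, mul_assoc, Finset.sum_add_distrib]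
    rw [← Finset.mul_sum, hz, hw, mul_sub, MonoidAlgebra.single_mul_single]
    simp
  | inv g _ hg =>
    obtain ⟨z, hz⟩ := hg
    refine ⟨fun i => - (MonoidAlgebra.single g⁻¹ 1 * z i), ?_⟩
    simp only [neg_mul, mul_assoc, Finset.sum_neg_distrib]
    rw [← Finset.mul_sum, hz, mul_sub, MonoidAlgebra.single_mul_single]
    simp [MonoidAlgebra.one_def]

/-- An element of the space of cocycles is given by the values of a function on the group that
satisfies the cocycle identity. -/
theorem exists_cocycle {ψ : GroupCharacter G} {t : ι → G}
    (ht : Subgroup.closure (Set.range t) = ⊤)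
    {η : ψ.EllFun ι} (hη : η ∈ ψ.cocycles (MonoidHom.id G) t) :
    ∃ c : G → ψ.Ell, (∀ g h, c (g * h) = c g + ψ.right g⁻¹ (c h)) ∧
      (∀ i, c (t i) = η i) ∧
      ∀ g (z : ι → MonoidAlgebra ℂ G),
        ∑ i, z i * (MonoidAlgebra.single (t i) 1 - 1) = MonoidAlgebra.single g 1 - 1 →
          c g = ∑ i, ψ.coRing (z i) (η i) := by
  classical
  choose w hw using exists_sum_mul_single_sub_one ht
  rw [mem_cocycles] at hη
  simp only [MonoidAlgebra.mapDomainRingHom_id, RingHom.id_apply] at hη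
  -- Two expansions of `g - 1` differ by a relation, which `η` annihilates, so the value of the
  -- cocycle at `g` is well defined.
  have wd : ∀ g (z : ι → MonoidAlgebra ℂ G),
      ∑ i, z i * (MonoidAlgebra.single (t i) 1 - 1) = MonoidAlgebra.single g 1 - 1 →
        ∑ i, ψ.coRing (w g i) (η i) = ∑ i, ψ.coRing (z i) (η i) := by
    intro g z hz
    have := hη (fun i => w g i - z i) (by
      simp only [sub_mul, Finset.sum_sub_distrib]
      rw [hw, hz, sub_self])
    simp only [map_sub, _root_.sub_apply, Finset.sum_sub_distrib] at this
    exact sub_eq_zero.1 this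
  refine ⟨fun g => ∑ i, ψ.coRing (w g i) (η i), fun g h => ?_, fun i => ?_, wd⟩
  · change ∑ i, ψ.coRing (w (g * h) i) (η i) = _
    rw [wd (g * h) (fun i => w g i + MonoidAlgebra.single g 1 * w h i) (by
      simp only [add_mul, mul_assoc, Finset.sum_add_distrib]
      rw [← Finset.mul_sum, hw, hw, mul_sub, MonoidAlgebra.single_mul_single]
      simp)]
    simp only [map_add, _root_.add_apply, Finset.sum_add_distrib, map_sum]
    congr 1
    refine Finset.sum_congr rfl fun i _ => ?_
    rw [map_mul]
    change ψ.coRing _ (ψ.coRing _ (η i)) = _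
    rw [coRing_single, _root_.map_one, one_smul]
  · change ∑ j, ψ.coRing (w (t i) j) (η j) = _
    rw [wd (t i) (Pi.single i 1) (by
      rw [Finset.sum_eq_single i]
      · simp
      · intro j _ hj; simp [hj]
      · simp)]
    rw [Finset.sum_eq_single i]
    · simp
    · intro j _ hj; simp [hj]
    · simp

section Cocycle

variable {ψ : GroupCharacter G} {c : G → ψ.Ell}

theorem cocycle_one (hc : ∀ g h, c (g * h) = c g + ψ.right g⁻¹ (c h)) : c 1 = 0 := by
  have := hc 1 1
  rw [inv_one, right_one, one_mul] at this
  exact left_eq_add.1 this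

/-- The subgroup of elements at which a cocycle vanishes. -/
def cocycleKer (c : G → ψ.Ell) (hc : ∀ g h, c (g * h) = c g + ψ.right g⁻¹ (c h)) :
    Subgroup G where
  carrier := {g | c g = 0}
  one_mem' := cocycle_one hc
  mul_mem' {g h} hg hh := by
    change c g = 0 at hg
    change c h = 0 at hh
    change c (g * h) = 0
    rw [hc, hg, hh, map_zero, add_zero]
  inv_mem' {g} hg := by
    change c g = 0 at hg
    change c g⁻¹ = 0
    have := hc g⁻¹ g
    rwa [inv_mul_cancel, cocycle_one hc, hg, map_zero, add_zero, eq_comm] at this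

theorem mem_cocycleKer (hc : ∀ g h, c (g * h) = c g + ψ.right g⁻¹ (c h)) {g : G} :
    g ∈ cocycleKer c hc ↔ c g = 0 := Iff.rfl

end Cocycle

/-- The core estimate: adjoining `a` adds to the cocycles only the freedom of choosing `c a`, which
is confined to a space of fixed vectors of dimension at most `1/|F|`. -/
theorem bettiOneOf_adjoin_le {χ : GroupCharacter Γ} {ψ : GroupCharacter G} (f : Γ →* G)
    (hf : ∀ x, ψ (f x) = χ x) {S : Finset Γ} {T : Finset G}
    (hS : Subgroup.closure (S : Set Γ) = ⊤) (hT : Subgroup.closure (T : Set G) = ⊤) {a : G}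
    (ha : Subgroup.closure ((f.range : Set G) ∪ {a}) = ⊤) {F : Finset G} (hF : F.Nonempty)
    (hψ : ∀ k ∈ F, ∀ l ∈ F, k ≠ l → ψ (k⁻¹ * l) = 0)
    (hFf : ∀ k ∈ F, k ∈ f.range ∧ a⁻¹ * k * a ∈ f.range) :
    ψ.bettiOneOf T - ψ.bettiZero ≤ χ.bettiOneOf S + 1 / (F.card : ℝ) := by
  have hT' : Subgroup.closure (Set.range (Subtype.val : T → G)) = ⊤ := by
    rw [← hT]; congr 1; ext; simp
  rw [bettiOneOf_eq ψ T hT, bettiOneOf_eq χ S hS, ← trace_cocycles_map ψ f hf S]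
  choose w hw using exists_sum_mul_single_sub_one hT'
  set Z := ψ.cocycles (MonoidHom.id G) (Subtype.val : T → G) with hZ
  -- In terms of cocycles, `A` restricts to the generators of `Γ` and `B` below evaluates at `a`;
  -- `N` consists of the cocycles vanishing on the image of `Γ`.
  set A : ψ.EllFun T →L[ℂ] ψ.EllFun S :=
    ψ.ofMatrix fun s t => ψ.coRing (w (f s) t) with hA
  set B : ψ.EllFun T →L[ℂ] ψ.EllFun Unit :=
    ψ.ofMatrix fun _ t => ψ.coRing (w a t) with hB
  have hAeq : LeftEquivariant A := leftEquivariant_ofMatrix fun _ _ _ _ => coRing_left _ _ _ _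
  have hBeq : LeftEquivariant B := leftEquivariant_ofMatrix fun _ _ _ _ => coRing_left _ _ _ _
  set N := Z ⊓ LinearMap.ker (A : ψ.EllFun T →ₗ[ℂ] ψ.EllFun S) with hN
  have hNinv : LeftInvariant N := (ψ.leftInvariant_cocycles _ _).inf
    (LeftInvariant.of_forall_mem_iff hAeq fun _ => Iff.rfl)
  have : N.HasOrthogonalProjection :=
    IsClosed.hasOrthogonalProjection ((ψ.isClosed_cocycles _ _).inter A.isClosed_ker)
  have step1 : trace Z.starProjection ≤ trace N.starProjection +
      trace (ψ.cocycles f (Subtype.val : S → Γ)).starProjection := by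
    refine trace_starProjection_le_add hAeq (ψ.leftInvariant_cocycles _ _) ?_
      fun x hx h => ⟨hx, h⟩
    intro η hη z hz
    rw [hZ, mem_cocycles] at hη
    simp only [MonoidAlgebra.mapDomainRingHom_id, RingHom.id_apply] at hη
    have h1 := hη
      (fun t => ∑ s : S, MonoidAlgebra.mapDomainRingHom ℂ f (z s) * w (f s) t) (by
        simp only [Finset.sum_mul, mul_assoc]
        rw [Finset.sum_comm]
        simp only [← Finset.mul_sum, hw]
        have := congrArg (MonoidAlgebra.mapDomainRingHom ℂ f) hz
        rw [map_sum, map_zero] at this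
        rw [← this]
        refine Finset.sum_congr rfl fun s _ => ?_
        rw [map_mul, map_sub, _root_.map_one]
        congr 2
        simp)
    rw [← h1]
    simp only [hA, ofMatrix_apply, map_sum, map_mul, _root_.sum_apply]
    rw [Finset.sum_comm]
    rfl
  have hBA : ∀ η ∈ N, (∀ k ∈ F, ψ.right k⁻¹ (B η ()) = B η ()) ∧ (B η = 0 → η = 0) := by
    intro η hη
    obtain ⟨c, hc, hct, hcz⟩ := exists_cocycle hT' hη.1
    have hca : B η () = c a := by
      rw [hcz a _ (hw a), hB, ofMatrix_apply]
    have hcf : f.range ≤ cocycleKer c hc := by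
      rw [MonoidHom.range_eq_map, ← hS, MonoidHom.map_closure, Subgroup.closure_le]
      rintro _ ⟨s, hs, rfl⟩
      change c (f s) = 0
      have h0 : A η = 0 := hη.2
      have := congrArg (fun ξ => ξ.ofLp ⟨s, hs⟩) h0
      simp only [hA, ofMatrix_apply] at this
      rw [hcz _ _ (hw (f s)), this]
      rfl
    refine ⟨fun k hk => ?_, fun h => ?_⟩
    -- Since `c` vanishes at `k` and at `a⁻¹ka`, expanding `c (k a)` and `c (a · a⁻¹ka)` gives
    -- `R_{k⁻¹} (c a) = c a`.
    · rw [hca]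
      have h1 := hc k a
      have h2 := hc a (a⁻¹ * k * a)
      have e : a * (a⁻¹ * k * a) = k * a := by group
      have h3 : c k = 0 := hcf (hFf k hk).1
      have h4 : c (a⁻¹ * k * a) = 0 := hcf (hFf k hk).2
      rw [e, h1, h3, h4, map_zero, zero_add, add_zero] at h2
      exact h2
    · have htop : cocycleKer c hc = ⊤ := by
        rw [eq_top_iff, ← ha, Subgroup.closure_le, Set.union_subset_iff,
          Set.singleton_subset_iff]
        refine ⟨hcf, ?_⟩
        change c a = 0
        rw [← hca, h]
        rfl
      ext t
      rw [← hct t]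
      change c t = 0
      rw [← mem_cocycleKer hc, htop]
      exact Subgroup.mem_top _
  have step2 : trace N.starProjection ≤ trace (⊥ : Submodule ℂ (ψ.EllFun T)).starProjection +
      trace (ψ.fixedUnit (Inv.inv '' (F : Set G))).starProjection := by
    refine trace_starProjection_le_add hBeq hNinv ?_ fun x hx h => (hBA x hx).2 h
    rintro η hη _ ⟨k, hk, rfl⟩
    exact (hBA η hη).1 k hk
  have h0 : trace (⊥ : Submodule ℂ (ψ.EllFun T)).starProjection = 0 := by
    simp [trace]
  have hfix : ψ.fixed (Inv.inv '' (F : Set G)) = ψ.fixed (F : Set G) := by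
    rw [← fixed_closure, Set.image_inv_eq_inv, Subgroup.closure_inv, fixed_closure]
  rw [h0, zero_add, trace_fixedUnit] at step2
  simp only [hfix] at step2
  have step3 := ψ.re_inner_fixed_le F hF hψ (subset_refl _)
  -- The term `-b₀` of the smaller group is discarded.
  have := χ.bettiZero_nonneg
  linarith

theorem bettiOne_adjoin_le [Group.FG G] [Group.FG Γ] {χ : GroupCharacter Γ} {ψ : GroupCharacter G}
    (f : Γ →* G) (hf : ∀ x, ψ (f x) = χ x) {a : G}
    (ha : Subgroup.closure ((f.range : Set G) ∪ {a}) = ⊤) {F : Finset G} (hF : F.Nonempty)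
    (hψ : ∀ k ∈ F, ∀ l ∈ F, k ≠ l → ψ (k⁻¹ * l) = 0)
    (hFf : ∀ k ∈ F, k ∈ f.range ∧ a⁻¹ * k * a ∈ f.range) :
    ψ.bettiOne - ψ.bettiZero ≤ χ.bettiOne + 1 / (F.card : ℝ) :=
  bettiOneOf_adjoin_le f hf (Classical.choose_spec (Group.FG.out (G := Γ)))
    (Classical.choose_spec (Group.FG.out (G := G))) ha hF hψ hFf

/-! ### The zeroth Betti number of subgroups -/

/-- The isometric embedding carries invariant vectors to vectors fixed by `f.range`, and their
complement to the complement. All the `b₀` of subgroups can thus be compared inside the single space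
`ℓ^ψ(G)`. -/
theorem bettiZero_eq_of_hom {χ : GroupCharacter Γ} {ψ : GroupCharacter G} (f : Γ →* G)
    (hf : ∀ x, ψ (f x) = χ x) : χ.bettiZero =
      (inner ℂ ((ψ.fixed (f.range : Set G)).starProjection (ψ.delta 1)) (ψ.delta 1)).re := by
  have h := Submodule.starProjection_map_of_inner (embed f hf).toLinearMap
    (V := χ.fixed Set.univ) (W := ψ.fixed (f.range : Set G)) (fun x hx => by
      rintro _ ⟨g, rfl⟩
      change ψ.right (f g) (embed f hf x) = embed f hf x
      rw [← embed_right, hx g trivial])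
    (fun x hx => by
      rw [fixed_eq_orthogonal, Submodule.orthogonal_orthogonal_eq_closure] at hx
      revert x
      change _ ≤ ((ψ.fixed (f.range : Set G))ᗮ).comap (embed f hf).toLinearMap
      refine Submodule.topologicalClosure_minimal _ (Submodule.span_le.2 ?_)
        ((Submodule.isClosed_orthogonal _).preimage (embed f hf).continuous)
      rintro _ ⟨g, -, ξ, rfl⟩
      rw [SetLike.mem_coe, Submodule.mem_comap, Submodule.mem_orthogonal']
      intro y hy
      change inner ℂ (embed f hf (χ.right g⁻¹ ξ - ξ)) y = 0
      rw [map_sub, embed_right, inner_sub_left, inner_right_left, _root_.map_inv f, inv_inv,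
        hy (f g) ⟨g, rfl⟩, sub_self]) (χ.delta 1)
  have h1 : embed f hf (χ.delta 1) = ψ.delta 1 := by rw [embed_delta, _root_.map_one f]
  rw [bettiZero_eq, ← inner_embed f hf, h1]
  change (ψ.fixed (f.range : Set G)).starProjection (embed f hf (χ.delta 1)) =
    embed f hf ((χ.fixed Set.univ).starProjection (χ.delta 1)) at h
  rw [← h, h1]

theorem _root_.Subgroup.fg_closure_singleton (g : G) : (Subgroup.closure {g}).FG :=
  ⟨{g}, by rw [Finset.coe_singleton]⟩

theorem _root_.Subgroup.FG.map {L : Subgroup Γ} (h : L.FG) (f : Γ →* G) : (L.map f).FG := by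
  obtain ⟨Q, rfl⟩ := h
  rw [MonoidHom.map_closure]
  exact (Subgroup.fg_iff _).2 ⟨_, rfl, Q.finite_toSet.image _⟩

instance : Nonempty {L : Subgroup G // L.FG} := ⟨⟨⊥, Subgroup.FG.bot⟩⟩

instance : IsDirectedOrder {L : Subgroup G // L.FG} :=
  ⟨fun L M => ⟨⟨L.1 ⊔ M.1, L.2.sup M.2⟩, Subtype.coe_le_coe.1 le_sup_left,
    Subtype.coe_le_coe.1 le_sup_right⟩⟩

/-- The fixed spaces decrease with `L` and meet in the `G`-fixed vectors, because each element lies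
in a finitely generated subgroup. Passing to complements gives an increasing family, whose
projections converge strongly. -/
theorem tendsto_bettiZero_restrict (ψ : GroupCharacter G) :
    Tendsto (fun L : {L : Subgroup G // L.FG} => (ψ.restrict L.1).bettiZero) atTop
      (nhds ψ.bettiZero) := by
  have hmono : Monotone fun L : {L : Subgroup G // L.FG} => (ψ.fixed (L.1 : Set G))ᗮ :=
    fun L M h => Submodule.orthogonal_le fun x hx g hg => hx g (h hg)
  have hsup : (⨆ L : {L : Subgroup G // L.FG}, (ψ.fixed (L.1 : Set G))ᗮ).topologicalClosure =
      (ψ.fixed Set.univ)ᗮ := by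
    rw [← Submodule.orthogonal_orthogonal_eq_closure, ← Submodule.iInf_orthogonal]
    congr 1
    simp only [Submodule.orthogonal_orthogonal]
    refine le_antisymm (fun x hx g _ => ?_) (le_iInf fun L x hx g _ => hx g trivial)
    exact (Submodule.mem_iInf _).1 hx
      ⟨Subgroup.closure {g}, Subgroup.fg_closure_singleton g⟩ g
      (Subgroup.subset_closure (Set.mem_singleton g))
  have h := Submodule.starProjection_tendsto_closure_iSup _ hmono (ψ.delta 1)
  simp only [hsup, Submodule.starProjection_orthogonal_val] at h
  have h' := (tendsto_const_nhds (x := ψ.delta 1)).sub h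
  simp only [sub_sub_cancel] at h'
  rw [bettiZero_eq]
  refine ((Complex.continuous_re.tendsto _).comp (h'.inner tendsto_const_nhds)).congr fun L => ?_
  have e := bettiZero_eq_of_hom (χ := ψ.restrict L.1) (ψ := ψ) L.1.subtype fun _ => rfl
  simp only [Subgroup.range_subtype] at e
  exact e.symm

theorem bettiZero_eq_zero_of_infinite (ψ : GroupCharacter G) {K : Subgroup G} (hK : Infinite K)
    (hreg : ψ.IsRegular K) : ψ.bettiZero = 0 := by
  refine le_antisymm (le_of_forall_pos_le_add fun ε hε => ?_) ψ.bettiZero_nonneg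
  obtain ⟨m, hm⟩ := exists_nat_one_div_lt hε
  obtain ⟨F, hFK, hFm⟩ :=
    (Set.infinite_coe_iff.1 hK : (K : Set G).Infinite).exists_subset_card_eq (m + 1)
  rw [zero_add, bettiZero_eq]
  refine (ψ.re_inner_fixed_le F (Finset.card_pos.1 (by omega)) (fun k hk l hl hkl => ?_)
    (Set.subset_univ _)).trans ?_
  · exact hreg _ (K.mul_mem (K.inv_mem (hFK hk)) (hFK hl)) fun h => hkl (inv_mul_eq_one.1 h)
  · rw [hFm]
    push_cast
    exact hm.le

/-! ### Finitely generated subgroups -/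

/-- Each generator of `M` is a word involving only finitely many elements of `H`. This makes the
subgroups `⟨L, a⟩` cofinal. -/
theorem exists_fg_le_closure {H : Subgroup G} {a : G}
    (hG : Subgroup.closure ((H : Set G) ∪ {a}) = ⊤) {M : Subgroup G} (hM : M.FG) :
    ∃ L : Subgroup H, L.FG ∧
      M ≤ Subgroup.closure ((L.map H.subtype : Subgroup G) ∪ {a} : Set G) := by
  have mono : ∀ {L L' : Subgroup H}, L ≤ L' →
      Subgroup.closure ((L.map H.subtype : Subgroup G) ∪ {a} : Set G) ≤
        Subgroup.closure ((L'.map H.subtype : Subgroup G) ∪ {a} : Set G) := fun h =>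
    Subgroup.closure_mono (Set.union_subset_union_left _ (Subgroup.map_mono h))
  have key : ∀ g : G, ∃ L : Subgroup H, L.FG ∧
      g ∈ Subgroup.closure ((L.map H.subtype : Subgroup G) ∪ {a} : Set G) := by
    intro g
    have hg : g ∈ Subgroup.closure ((H : Set G) ∪ {a}) := hG ▸ Subgroup.mem_top g
    induction hg using Subgroup.closure_induction with
    | mem g hg =>
      rcases hg with hg | hg
      · refine ⟨Subgroup.closure {⟨g, hg⟩}, Subgroup.fg_closure_singleton _,
          Subgroup.subset_closure (Or.inl ?_)⟩
        exact Subgroup.mem_map_of_mem H.subtype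
          (Subgroup.subset_closure (Set.mem_singleton (⟨g, hg⟩ : H)))
      · exact ⟨⊥, Subgroup.FG.bot, Subgroup.subset_closure (Or.inr hg)⟩
    | one => exact ⟨⊥, Subgroup.FG.bot, one_mem _⟩
    | mul g h _ _ hg hh =>
      obtain ⟨L, hL, hg⟩ := hg
      obtain ⟨L', hL', hh⟩ := hh
      exact ⟨L ⊔ L', hL.sup hL', mul_mem (mono le_sup_left hg) (mono le_sup_right hh)⟩
    | inv g _ hg =>
      obtain ⟨L, hL, hg⟩ := hg
      exact ⟨L, hL, inv_mem hg⟩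
  choose L hL hgL using key
  obtain ⟨Q, rfl⟩ := hM
  refine ⟨Q.sup L, ?_, ?_⟩
  · exact Finset.sup_induction Subgroup.FG.bot (fun _ h _ h' => h.sup h') fun g _ => hL g
  · rw [Subgroup.closure_le]
    exact fun g hg => mono (Finset.le_sup hg) (hgL g)

/-! ### The lower limit -/

theorem _root_.EReal.le_of_forall_pos_le_add_coe {x y : EReal}
    (h : ∀ ε : ℝ, 0 < ε → x ≤ y + (ε : EReal)) : x ≤ y := by
  induction y with
  | bot => simpa using h 1 one_pos
  | top => exact le_top
  | coe y =>
    induction x with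
    | bot => exact bot_le
    | top => exact absurd (h 1 one_pos) (by
      rw [← EReal.coe_add]; exact not_le.2 (EReal.coe_lt_top _))
    | coe x =>
      rw [EReal.coe_le_coe_iff]
      refine le_of_forall_pos_le_add fun ε hε => ?_
      exact_mod_cast h ε hε

theorem bettiOneBar_adjoin_le {H : Subgroup G} {a : G}
    (hG : Subgroup.closure ((H : Set G) ∪ {a}) = ⊤) (ψ : GroupCharacter G) {F : Finset G}
    (hF : F.Nonempty) (hψ : ∀ k ∈ F, ∀ l ∈ F, k ≠ l → ψ (k⁻¹ * l) = 0)
    (hFH : ∀ k ∈ F, k ∈ H ∧ a⁻¹ * k * a ∈ H) :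
    ψ.bettiOneBar ≤ (ψ.restrict H).bettiOneBar +
      ((ψ.bettiZero + 1 / (F.card : ℝ) : ℝ) : EReal) := by
  classical
  refine EReal.le_of_forall_pos_le_add_coe fun ε hε => ?_
  rw [add_assoc, ← EReal.coe_add]
  -- Isolating the lower limit for `H` allows it to be replaced by any `b` above it; arbitrarily
  -- large `L ≤ H` then have `b₁(L) < b`.
  rw [← EReal.sub_le_iff_le_add (Or.inl (EReal.coe_ne_bot _)) (Or.inl (EReal.coe_ne_top _))]
  refine le_of_forall_gt_imp_ge_of_dense fun b hb => ?_
  rw [EReal.sub_le_iff_le_add (Or.inl (EReal.coe_ne_bot _)) (Or.inl (EReal.coe_ne_top _))]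
  refine liminf_le_of_frequently_le' ?_
  have hfreq := frequently_lt_of_liminf_lt (by isBoundedDefault) hb
  rw [frequently_atTop] at hfreq ⊢
  obtain ⟨M₁, hM₁⟩ := eventually_atTop.1
    (ψ.tendsto_bettiZero_restrict.eventually (gt_mem_nhds (lt_add_of_pos_right ψ.bettiZero hε)))
  intro M₀
  obtain ⟨L₁, hL₁, hML₁⟩ := exists_fg_le_closure hG (M₀.2.sup M₁.2)
  -- `L` must contain `F` and `a⁻¹Fa` for the core estimate to apply. It must also contain `L₁`, so
  -- that `⟨L, a⟩` lies above the prescribed `M₀` and above `M₁`, past which `b₀` is less than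
  -- `b₀(G) + ε`.
  set X : Set H := H.subtype ⁻¹' ((F : Set G) ∪ (fun k => a⁻¹ * k * a) '' (F : Set G)) with hX
  have hXfin : X.Finite :=
    (F.finite_toSet.union (F.finite_toSet.image _)).preimage H.subtype_injective.injOn
  obtain ⟨L, hL, hLb⟩ := hfreq ⟨L₁ ⊔ Subgroup.closure X,
    hL₁.sup ((Subgroup.fg_iff _).2 ⟨X, rfl, hXfin⟩)⟩
  have hL : L₁ ⊔ Subgroup.closure X ≤ L.1 := hL
  set Y : Set G := (L.1.map H.subtype : Subgroup G) ∪ {a} with hY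
  set M := Subgroup.closure Y with hM
  have hMFG : M.FG := by
    rw [hM, hY, Subgroup.closure_union, Subgroup.closure_eq]
    exact (Subgroup.FG.map L.2 _).sup (Subgroup.fg_closure_singleton a)
  have hle : M₀.1 ⊔ M₁.1 ≤ M := hML₁.trans (Subgroup.closure_mono
    (Set.union_subset_union_left _ (Subgroup.map_mono (le_sup_left.trans hL))))
  refine ⟨⟨M, hMFG⟩, le_sup_left.trans hle, ?_⟩
  have hb0 : (ψ.restrict M).bettiZero < ψ.bettiZero + ε := hM₁ ⟨M, hMFG⟩ (le_sup_right.trans hle)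
  have hLM : ∀ x : L.1, ((x : H) : G) ∈ M := fun x =>
    Subgroup.subset_closure (Or.inl ⟨x, x.2, rfl⟩)
  let f : L.1 →* M := (H.subtype.comp L.1.subtype).codRestrict M hLM
  have hfr : ∀ x : M, x ∈ f.range ↔ (x : G) ∈ L.1.map H.subtype := by
    intro x
    constructor
    · rintro ⟨y, rfl⟩
      exact ⟨y, y.2, rfl⟩
    · rintro ⟨y, hy, hyx⟩
      exact ⟨⟨y, hy⟩, Subtype.ext hyx⟩
  have haM : a ∈ M := Subgroup.subset_closure (Or.inr rfl)
  have hgen : Subgroup.closure ((f.range : Set M) ∪ {⟨a, haM⟩}) = ⊤ := by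
    rw [← Subgroup.closure_closure_coe_preimage (k := Y)]
    congr 1
    ext x
    simp only [Set.mem_union, SetLike.mem_coe, hfr, Set.mem_singleton_iff, Set.mem_preimage, hY,
      Subtype.ext_iff]
  have hXL : ∀ g (hg : g ∈ H), g ∈ (F : Set G) ∪ (fun k => a⁻¹ * k * a) '' (F : Set G) →
      g ∈ L.1.map H.subtype := fun g hg hgX =>
    ⟨⟨g, hg⟩, hL (Subgroup.mem_sup_right (Subgroup.subset_closure hgX)), rfl⟩
  have hFM : ∀ k ∈ F, k ∈ M := fun k hk =>
    Subgroup.subset_closure (Or.inl (hXL k (hFH k hk).1 (Or.inl hk)))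
  have hcard : (F.subtype (· ∈ M)).card = F.card := by
    rw [Finset.card_subtype, Finset.filter_true_of_mem hFM]
  have : Group.FG L.1 := (Group.fg_iff_subgroup_fg L.1).2 L.2
  have : Group.FG M := (Group.fg_iff_subgroup_fg M).2 hMFG
  have main := bettiOne_adjoin_le (χ := (ψ.restrict H).restrict L.1) (ψ := ψ.restrict M) f
    (fun _ => rfl) hgen (F := F.subtype (· ∈ M))
    (Finset.card_pos.1 (hcard ▸ hF.card_pos))
    (fun k hk l hl hkl => hψ k (Finset.mem_subtype.1 hk) l (Finset.mem_subtype.1 hl)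
      fun h => hkl (Subtype.ext h))
    (fun k hk => by
      have hk' := Finset.mem_subtype.1 hk
      rw [hfr, hfr]
      exact ⟨hXL _ (hFH _ hk').1 (Or.inl hk'),
        hXL _ (hFH _ hk').2 (Or.inr ⟨_, hk', rfl⟩)⟩)
  rw [hcard] at main
  have main' : (ψ.restrict M).bettiOne ≤ ((ψ.restrict H).restrict L.1).bettiOne +
      (ψ.bettiZero + 1 / (F.card : ℝ) + ε) := by linarith
  calc (((ψ.restrict M).bettiOne : ℝ) : EReal)
      ≤ ((((ψ.restrict H).restrict L.1).bettiOne +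
        (ψ.bettiZero + 1 / (F.card : ℝ) + ε) : ℝ) : EReal) := EReal.coe_le_coe_iff.2 main'
    _ = ((((ψ.restrict H).restrict L.1).bettiOne : ℝ) : EReal) +
        ((ψ.bettiZero + 1 / (F.card : ℝ) + ε : ℝ) : EReal) := EReal.coe_add _ _
    _ ≤ b + ((ψ.bettiZero + 1 / (F.card : ℝ) + ε : ℝ) : EReal) := by gcongr

/-- Cauchy–Schwarz for the unit vectors `δ₁` and `δ_a`. -/
theorem neg_one_le_re (ψ : GroupCharacter G) (a : G) : -1 ≤ (ψ a).re := by
  have h := norm_inner_le_norm (𝕜 := ℂ) (ψ.delta 1) (ψ.delta a)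
  rw [inner_delta, norm_delta, norm_delta, inv_one, one_mul, one_mul] at h
  exact (abs_le.1 ((Complex.abs_re_le_norm _).trans h)).1

end GroupCharacter

/-! ### From finite subsets of `K` to the stated bound -/

theorem mainTheorem7 {G : Type*} [Group G] (H : Subgroup G) (a : G)
    (hG : Subgroup.closure ((H : Set G) ∪ {a}) = ⊤)
    (ψ : GroupCharacter G) (n : ℕ∞) (K : Subgroup G) (hKn : ENat.card K = n)
    (hK : K ≤ H.map (MulAut.conj a).toMonoidHom ⊓ H) (hreg : ψ.IsRegular K) :
    (ψ.bettiOneBar - (ψ.bettiZero : EReal) ≤ (ψ.restrict H).bettiOneBar +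
        ((3 + 2 * (ψ a).re : ℝ) : EReal) /
          (((n : ENNReal) : EReal) + ((2 + 2 * (ψ a).re : ℝ) : EReal))) ∧
      (n = ⊤ → ψ.bettiOneBar ≤ (ψ.restrict H).bettiOneBar) := by
  -- Regularity makes distinct elements of `K` orthogonal, and `K ≤ aHa⁻¹ ∩ H` puts both `k` and
  -- `a⁻¹ka` in `H`.
  have key : ∀ F : Finset G, F.Nonempty → (F : Set G) ⊆ K → ψ.bettiOneBar ≤
      (ψ.restrict H).bettiOneBar + ((ψ.bettiZero + 1 / (F.card : ℝ) : ℝ) : EReal) := by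
    intro F hF hFK
    refine GroupCharacter.bettiOneBar_adjoin_le hG ψ hF (fun k hk l hl hkl => ?_) fun k hk => ?_
    · exact hreg _ (K.mul_mem (K.inv_mem (hFK hk)) (hFK hl)) fun h => hkl (inv_mul_eq_one.1 h)
    · obtain ⟨⟨h, hh, rfl⟩, hkH⟩ := hK (hFK hk)
      refine ⟨hkH, ?_⟩
      simpa [mul_assoc] using hh
  have hr := ψ.neg_one_le_re a
  have top : n = ⊤ → ψ.bettiZero = 0 ∧ ψ.bettiOneBar ≤ (ψ.restrict H).bettiOneBar := by
    intro hn
    have hKinf : Infinite K := by rwa [hn, ENat.card_eq_top] at hKn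
    have hb0 := ψ.bettiZero_eq_zero_of_infinite hKinf hreg
    refine ⟨hb0, EReal.le_of_forall_pos_le_add_coe fun ε hε => ?_⟩
    obtain ⟨m, hm⟩ := exists_nat_one_div_lt hε
    obtain ⟨F, hFK, hFm⟩ :=
      (Set.infinite_coe_iff.1 hKinf : (K : Set G).Infinite).exists_subset_card_eq (m + 1)
    refine (key F (Finset.card_pos.1 (by omega)) hFK).trans ?_
    gcongr
    rw [hb0, zero_add, hFm]
    push_cast
    exact hm.le
  refine ⟨?_, fun hn => (top hn).2⟩
  induction n with
  | top =>
    obtain ⟨hb0, hle⟩ := top rfl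
    have e : (((⊤ : ℕ∞) : ENNReal) : EReal) = ⊤ := by simp
    rw [e, EReal.top_add_coe, EReal.div_top, hb0, EReal.coe_zero, sub_zero, add_zero]
    exact hle
  | coe n =>
    have hKfin : Finite K := by
      by_contra h
      rw [not_finite_iff_infinite] at h
      rw [ENat.card_eq_top_of_infinite] at hKn
      exact ENat.top_ne_natCast _ hKn
    have hcard : Nat.card K = n := by
      rw [ENat.card_eq_coe_natCard] at hKn
      exact_mod_cast hKn
    have hfin : (K : Set G).Finite := Set.toFinite _
    have hFn : hfin.toFinset.card = n := by
      rw [← Set.ncard_eq_toFinset_card (K : Set G) hfin, ← hcard]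
      rfl
    have hF := key hfin.toFinset ⟨1, by simp [K.one_mem]⟩ (by simp)
    have hn1 : 1 ≤ n := hcard ▸ Nat.card_pos
    have hn1' : (1 : ℝ) ≤ n := by exact_mod_cast hn1
    rw [hFn] at hF
    rw [EReal.sub_le_iff_le_add (Or.inl (EReal.coe_ne_bot _)) (Or.inl (EReal.coe_ne_top _))]
    refine hF.trans ?_
    have e : (((n : ℕ∞) : ENNReal) : EReal) = ((n : ℝ) : EReal) := by
      rw [ENat.toENNReal_coe]; rfl
    rw [e, ← EReal.coe_add, ← EReal.coe_div, add_assoc, ← EReal.coe_add]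
    -- After cross-multiplying, the difference of the two sides is `(n - 1)(2 + 2 Re ψ(a)) ≥ 0`.
    have hfrac : 1 / (n : ℝ) ≤ (3 + 2 * (ψ a).re) / (n + (2 + 2 * (ψ a).re)) := by
      rw [div_le_div_iff₀ (by linarith) (by linarith)]
      nlinarith
    exact add_le_add le_rfl (EReal.coe_le_coe_iff.2 (by linarith))

end
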